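/- Let $0<p\le 1$ and let $\mathbb K$ be $\mathbb R$ or $\mathbb C$. A $p$-norm on a $\mathbb K$-linear space is a map $\|\cdot\|\ge 0$ with $\|x\|=0\iff x=0$, $\|\lambda x\|=|\lambda|\|x\|$ and $\|x+y\|^p\le\|x\|^p+\|y\|^p$; a $p$-Banach space is a linear space with a complete $p$-norm. A contractive pair $u:E\rightleftarrows F$ between $p$-normed spaces consists of linear maps $u^\flat:E\to F$ and $u^\sharp:F\to E$ of norm at most $1$ with $u^\sharp u^\flat=\mathbf 1_E$; pairs are composed by $v\circ u=\langle v^\flat u^\flat,u^\sharp v^\sharp\rangle$. A subspace $Y$ of $X$ is 1-complemented if there is a linear projection of $X$ onto $Y$ of norm at most $1$. A 1FDD (monotone finite dimensional decomposition) of $X$ is an increasing sequence $(X_n)$ of finite dimensional subspaces of $X$ with dense union, such that $X_n$ is 1-complemented in $X_{n+1}$ for each $n$. A point of $\mathbb K^n$ is rational if (the real and imaginary parts of) its coordinates are rational, and a linear map $\mathbb K^n\to\mathbb K^m$ is rational if it maps rational points to rational points. The allowed $p$-norms on the spaces $\mathbb K^n$, $n\ge 0$, form the smallest class of $p$-norms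 such that: 1. every rational $p$-norm, that is, one of the form $|x|=\inf\{(\sum_i|\lambda_i|^p)^{1/p}:x=\sum_i\lambda_ix_i\}$ for a finite set $(x_i)$ of rational points, is allowed; 2. if $f:\mathbb K^n\to\mathbb K^m$ is rational and injective and $|\cdot|$ is allowed on $\mathbb K^m$, then $x\mapsto|f(x)|$ is allowed on $\mathbb K^n$; 3. if $|\cdot|_1$, $|\cdot|_2$ are allowed on $\mathbb K^n$, $\mathbb K^m$, then $\max(|x|_1,|y|_2)$ is allowed on $\mathbb K^{n+m}$; 4. if $|\cdot|_1$, $|\cdot|_2$ are allowed on $\mathbb K^n$, $\mathbb K^m$, $f:\mathbb K^n\to\mathbb K^m$ is rational and $\varepsilon>0$ is rational, then $\|y\|=\inf\{(|x|_1^p+(1+\varepsilon)^p|z|_2^p)^{1/p}:y=f(x)+z,\ x\in\mathbb K^n,\ z\in\mathbb K^m\}$ is allowed on $\mathbb K^m$. An allowed space is some $\mathbb K^n$ with an allowed $p$-norm, and an allowed pair is a contractive pair $u$ between allowed spaces such that $u^\flat$ and $u^\sharp$ are rational. A sequence of allowed pairs $u_n:U_n\rightleftarrows U_{n+1}$, $n\ge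 0$, is a Fraïssé sequence if for every $n$ and every allowed pair $v:U_n\rightleftarrows F$ there are $m>n$ and an allowed pair $w:F\rightleftarrows U_m$ such that $w\circ v$ is the bonding pair $u_{m-1}\circ\cdots\circ u_n:U_n\rightleftarrows U_m$. The space $\mathscr K_p$ is the direct limit, in the category of $p$-Banach spaces, of the inductive system $U_0\to U_1\to U_2\to\cdots$ of the isometric embeddings $u_n^\flat$ of a Fraïssé sequence of allowed pairs; equivalently, it is the completion of the union of the $U_n$. **Proposition.** A space $\mathscr K_p$ exists; and, whichever Fraïssé sequence of allowed pairs is used to form $\mathscr K_p$, every $p$-Banach space with a 1FDD is isometric to a 1-complemented subspace of $\mathscr K_p$. -/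

import Mathlib

universe u v w

/-- A `p`-norm on a linear space `X` over `𝕜`. -/
structure PNorm (p : ℝ) (𝕜 : Type*) [RCLike 𝕜] (X : Type*) [AddCommGroup X] [Module 𝕜 X] where
  toFun : X → ℝ
  nonneg' : ∀ x, 0 ≤ toFun x
  eq_zero_iff' : ∀ x, toFun x = 0 ↔ x = 0
  smul' : ∀ (c : 𝕜) (x : X), toFun (c • x) = ‖c‖ * toFun x
  add_rpow_le' : ∀ x y, toFun (x + y) ^ p ≤ toFun x ^ p + toFun y ^ p

namespace PNorm

variable {p : ℝ} {𝕜 : Type*} [RCLike 𝕜] {X : Type*} [AddCommGroup X] [Module 𝕜 X]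

instance : CoeFun (PNorm p 𝕜 X) (fun _ => X → ℝ) := ⟨PNorm.toFun⟩

/-- Completeness: every Cauchy sequence converges. The linear topology given by a `p`-norm `N` is
induced by the metric `N (x - y) ^ p`, so sequences suffice. A `p`-Banach space is a linear space
with a complete `p`-norm. -/
def IsComplete (N : PNorm p 𝕜 X) : Prop :=
  ∀ s : ℕ → X, (∀ ε : ℝ, 0 < ε → ∃ n, ∀ k ≥ n, ∀ l ≥ n, N (s k - s l) < ε) →
    ∃ x : X, ∀ ε : ℝ, 0 < ε → ∃ n, ∀ k ≥ n, N (s k - x) < ε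

/-- The `p`-norm that a subspace inherits. -/
def restrict (N : PNorm p 𝕜 X) (Y : Submodule 𝕜 X) : PNorm p 𝕜 Y where
  toFun y := N (y : X)
  nonneg' y := N.nonneg' y
  eq_zero_iff' y := by rw [N.eq_zero_iff', Submodule.coe_eq_zero]
  smul' c y := N.smul' c y
  add_rpow_le' x y := N.add_rpow_le' x y

/-- `Y` is 1-complemented: there is a contractive linear projection of the whole space onto `Y`. -/
def IsOneComplemented (N : PNorm p 𝕜 X) (Y : Submodule 𝕜 X) : Prop :=
  ∃ P : X →ₗ[𝕜] Y, (∀ y : Y, P (y : X) = y) ∧ ∀ x, N (P x : X) ≤ N x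

/-- There is a monotone finite dimensional decomposition (1FDD): a chain of finite dimensional
subspaces with dense union, each of them 1-complemented in the next one. -/
def HasOneFDD (N : PNorm p 𝕜 X) : Prop :=
  ∃ S : ℕ → Submodule 𝕜 X, Monotone S ∧
    (∀ n, FiniteDimensional 𝕜 (S n)) ∧
    (∀ (x : X) (ε : ℝ), 0 < ε → ∃ n, ∃ y ∈ S n, N (x - y) < ε) ∧
    ∀ n, (N.restrict (S (n + 1))).IsOneComplemented ((S n).submoduleOf (S (n + 1)))

end PNorm

/-- A contractive pair: a contractive embedding `emb` (the part `u♭`) together with a contractive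
projection `proj` (the part `u♯`) along it. -/
@[ext]
structure ContractivePair {p : ℝ} {𝕜 : Type*} [RCLike 𝕜]
    {E : Type*} [AddCommGroup E] [Module 𝕜 E] {F : Type*} [AddCommGroup F] [Module 𝕜 F]
    (N : PNorm p 𝕜 E) (M : PNorm p 𝕜 F) where
  emb : E →ₗ[𝕜] F
  proj : F →ₗ[𝕜] E
  proj_emb : ∀ x, proj (emb x) = x
  emb_le : ∀ x, M (emb x) ≤ N x
  proj_le : ∀ y, N (proj y) ≤ M y

namespace ContractivePair

variable {p : ℝ} {𝕜 : Type*} [RCLike 𝕜]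
  {E : Type*} [AddCommGroup E] [Module 𝕜 E] {F : Type*} [AddCommGroup F] [Module 𝕜 F]
  {G : Type*} [AddCommGroup G] [Module 𝕜 G]
  {N : PNorm p 𝕜 E} {M : PNorm p 𝕜 F} {L : PNorm p 𝕜 G}

/-- The identity pair. -/
def refl (N : PNorm p 𝕜 E) : ContractivePair N N where
  emb := LinearMap.id
  proj := LinearMap.id
  proj_emb _ := rfl
  emb_le _ := le_rfl
  proj_le _ := le_rfl

/-- The composition `v ∘ u` of pairs. -/
def comp (v : ContractivePair M L) (u : ContractivePair N M) : ContractivePair N L where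
  emb := v.emb ∘ₗ u.emb
  proj := u.proj ∘ₗ v.proj
  proj_emb x := by simp [v.proj_emb, u.proj_emb]
  emb_le x := (v.emb_le _).trans (u.emb_le _)
  proj_le y := (u.proj_le _).trans (v.proj_le _)

end ContractivePair

/-- Rational points of `𝕜ⁿ`: the real and imaginary parts of all coordinates are rational
(for real scalars `RCLike.I = 0`). -/
def IsRationalPoint {𝕜 : Type*} [RCLike 𝕜] {n : ℕ} (x : Fin n → 𝕜) : Prop :=
  ∀ i, ∃ a b : ℚ, x i = (a : 𝕜) + (b : 𝕜) * RCLike.I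

/-- Rational linear maps carry rational points into rational points. -/
def IsRationalMap {𝕜 : Type*} [RCLike 𝕜] {n m : ℕ} (f : (Fin n → 𝕜) →ₗ[𝕜] (Fin m → 𝕜)) : Prop :=
  ∀ x, IsRationalPoint x → IsRationalPoint (f x)

/-- Rational `p`-norms: the unit ball is the `p`-convex hull of a finite set of rational points. -/
def PNorm.IsRational {p : ℝ} {𝕜 : Type*} [RCLike 𝕜] {n : ℕ} (N : PNorm p 𝕜 (Fin n → 𝕜)) : Prop :=
  ∃ (k : ℕ) (v : Fin k → Fin n → 𝕜), (∀ i, IsRationalPoint (v i)) ∧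
    ∀ x, IsGLB {r : ℝ | ∃ c : Fin k → 𝕜, x = ∑ i, c i • v i ∧ r = (∑ i, ‖c i‖ ^ p) ^ (1 / p)} (N x)

/-- The smallest class of `p`-norms on the spaces `𝕜ⁿ`, `n ≥ 0`, that is closed under the four
rules below. -/
inductive PNorm.IsAllowed {p : ℝ} {𝕜 : Type*} [RCLike 𝕜] :
    ∀ {n : ℕ}, PNorm p 𝕜 (Fin n → 𝕜) → Prop
  | rational {n : ℕ} (N : PNorm p 𝕜 (Fin n → 𝕜)) (hN : N.IsRational) : PNorm.IsAllowed N
  | pullback {n m : ℕ} (f : (Fin n → 𝕜) →ₗ[𝕜] (Fin m → 𝕜)) (hf : IsRationalMap f)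
      (hinj : Function.Injective f) (M : PNorm p 𝕜 (Fin m → 𝕜)) (hM : PNorm.IsAllowed M)
      (N : PNorm p 𝕜 (Fin n → 𝕜)) (hN : ∀ x, N x = M (f x)) : PNorm.IsAllowed N
  | prod {n m : ℕ} (N₁ : PNorm p 𝕜 (Fin n → 𝕜)) (h₁ : PNorm.IsAllowed N₁)
      (N₂ : PNorm p 𝕜 (Fin m → 𝕜)) (h₂ : PNorm.IsAllowed N₂)
      (N : PNorm p 𝕜 (Fin (n + m) → 𝕜))
      (hN : ∀ x y, N (Fin.append x y) = max (N₁ x) (N₂ y)) : PNorm.IsAllowed N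
  | amalgam {n m : ℕ} (N₁ : PNorm p 𝕜 (Fin n → 𝕜)) (h₁ : PNorm.IsAllowed N₁)
      (N₂ : PNorm p 𝕜 (Fin m → 𝕜)) (h₂ : PNorm.IsAllowed N₂)
      (f : (Fin n → 𝕜) →ₗ[𝕜] (Fin m → 𝕜)) (hf : IsRationalMap f) (ε : ℚ) (hε : 0 < ε)
      (N : PNorm p 𝕜 (Fin m → 𝕜))
      (hN : ∀ y, IsGLB {r : ℝ | ∃ (x : Fin n → 𝕜) (z : Fin m → 𝕜), y = f x + z ∧
        r = (N₁ x ^ p + (1 + (ε : ℝ)) ^ p * N₂ z ^ p) ^ (1 / p)} (N y)) : PNorm.IsAllowed N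

/-- An allowed space: some `𝕜ⁿ` with an allowed `p`-norm. -/
structure AllowedSpace (p : ℝ) (𝕜 : Type*) [RCLike 𝕜] where
  dim : ℕ
  norm : PNorm p 𝕜 (Fin dim → 𝕜)
  allowed : norm.IsAllowed

/-- A contractive pair between allowed spaces is allowed if both of its maps are rational. -/
def ContractivePair.IsAllowed {p : ℝ} {𝕜 : Type*} [RCLike 𝕜] {E F : AllowedSpace p 𝕜}
    (u : ContractivePair E.norm F.norm) : Prop :=
  IsRationalMap u.emb ∧ IsRationalMap u.proj

/-- A sequence `U₀ ⇄ U₁ ⇄ U₂ ⇄ ⋯` of allowed pairs. -/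
structure AllowedSequence (p : ℝ) (𝕜 : Type*) [RCLike 𝕜] where
  space : ℕ → AllowedSpace p 𝕜
  pair : ∀ n, ContractivePair (space n).norm (space (n + 1)).norm
  pair_allowed : ∀ n, (pair n).IsAllowed

namespace AllowedSequence

variable {p : ℝ} {𝕜 : Type*} [RCLike 𝕜]

/-- The bonding pair from `Uₙ` to `Uₙ₊ₖ`. -/
def bond (U : AllowedSequence p 𝕜) (n : ℕ) :
    ∀ k : ℕ, ContractivePair (U.space n).norm (U.space (n + k)).norm
  | 0 => ContractivePair.refl _
  | k + 1 => (U.pair (n + k)).comp (U.bond n k)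

/-- The Fraïssé property: every allowed pair `v : Uₙ ⇄ F` is absorbed by the sequence, that is,
`w ∘ v` is a bonding pair `Uₙ ⇄ Uₘ`, `m > n`, for some allowed pair `w : F ⇄ Uₘ`. -/
def IsFraisse (U : AllowedSequence p 𝕜) : Prop :=
  ∀ (n : ℕ) (F : AllowedSpace p 𝕜) (v : ContractivePair (U.space n).norm F.norm), v.IsAllowed →
    ∃ k : ℕ, 1 ≤ k ∧ ∃ w : ContractivePair F.norm (U.space (n + k)).norm,
      w.IsAllowed ∧ w.comp v = U.bond n k

/-- `(K, N)` is the direct limit, in the category of `p`-Banach spaces, of the inductive system of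
the embeddings `Uₙ → Uₙ₊₁`: it is complete, and it is the closure of the union of an increasing
sequence of compatible isometric copies of the spaces `Uₙ`. -/
def IsDirectLimit (U : AllowedSequence p 𝕜) {K : Type*} [AddCommGroup K] [Module 𝕜 K]
    (N : PNorm p 𝕜 K) : Prop :=
  N.IsComplete ∧
  ∃ i : ∀ n, (Fin (U.space n).dim → 𝕜) →ₗ[𝕜] K,
    (∀ n x, N (i n x) = (U.space n).norm x) ∧
    (∀ n x, i (n + 1) ((U.pair n).emb x) = i n x) ∧
    ∀ (y : K) (ε : ℝ), 0 < ε → ∃ n x, N (y - i n x) < ε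

end AllowedSequence

/-- `(K, N)` is the space `𝒦ₚ`: the direct limit of a Fraïssé sequence of allowed pairs. -/
def IsKpSpace {p : ℝ} {𝕜 : Type*} [RCLike 𝕜] {K : Type*} [AddCommGroup K] [Module 𝕜 K]
    (N : PNorm p 𝕜 K) : Prop :=
  ∃ U : AllowedSequence p 𝕜, U.IsFraisse ∧ U.IsDirectLimit N

/-! Existence. A `p`-norm in the allowed class is determined by finitely many countable data, so
there are countably many allowed spaces and pairs. Two allowed pairs out of `E` are amalgamated over
the pullback of their projections, with the maximum norm (`AllowedPair.exists_amalgam`). The usual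
bookkeeping then yields a Fraïssé sequence (`exists_isFraisse`). Its limit is realised inside the
product of the `Uₘ`: a vector of `Uₙ` becomes the sequence of its images under bonding maps,
embeddings above `n` and projections below, and the uniform closure of these sequences under the
supremum norm is the limit.

Universality. A 1FDD of `X` is replaced by rational `p`-norms and rational contractions `fₙ : Eₙ →
Eₙ₊₁`, `gₙ : Eₙ₊₁ → Eₙ` with `gₙ fₙ` only close to the identity
(`PNorm.HasOneFDD.nonempty_allowedApproximation`). There is no need to perturb these to contractive
pairs. For arbitrary rational contractions `φ : Uₖ → E` and `ψ : E → Uₖ`, the graphs `u ↦ (u, φ u)`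
and `x ↦ (ψ x, x)` are contractively complemented in the max-product `Uₖ × E` by the coordinate
projections. The Fraïssé property absorbs the first graph, and the second then gives an allowed pair
`J : E ⇄ Uₘ` with `J♯ = φ` on `Uₖ` and `J♭ φ u` as close to `u` as `ψ φ u` is
(`AllowedSequence.IsFraisse.exists_absorb`).

Iterating with `φ = fₙ Jₙ♯` and `ψ = Jₙ♭ gₙ` gives pairs `Jₙ : Eₙ ⇄ U_{k n}` with geometrically
small errors. The maps `Jₙ♭` converge to a contraction `L : X → K` and the maps `Jₙ♯` to a
contraction `P : K → X`. Since `Jₙ♯ Jₙ♭ = 1`, also `P L = 1`, so `L` is isometric and `L P` is the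
projection onto its range. -/

open Filter Topology

/-! ### The metric of a `p`-norm and extension of contractions -/

namespace PNorm

variable {p : ℝ} {𝕜 : Type*} [RCLike 𝕜] {X : Type*} [AddCommGroup X] [Module 𝕜 X]
  {Y : Type*} [AddCommGroup Y] [Module 𝕜 Y]

/-- The `p`-th power of a `p`-norm, which is subadditive. -/
noncomputable def q (N : PNorm p 𝕜 X) (x : X) : ℝ := N x ^ p

theorem ext_apply {N M : PNorm p 𝕜 X} (h : ∀ x, N x = M x) : N = M := by
  cases N; cases M; congr; exact funext h

variable (N : PNorm p 𝕜 X) (M : PNorm p 𝕜 Y)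

theorem q_nonneg (x : X) : 0 ≤ N.q x := Real.rpow_nonneg (N.nonneg' x) p

theorem q_add_le (x y : X) : N.q (x + y) ≤ N.q x + N.q y := N.add_rpow_le' x y

theorem q_smul (c : 𝕜) (x : X) : N.q (c • x) = ‖c‖ ^ p * N.q x := by
  rw [q, N.smul', Real.mul_rpow (norm_nonneg c) (N.nonneg' x), q]

theorem map_zero : N 0 = 0 := (N.eq_zero_iff' 0).2 rfl

theorem map_neg (x : X) : N (-x) = N x := by
  have := N.smul' (-1) x
  simpa using this

theorem map_sub_comm (x y : X) : N (x - y) = N (y - x) := by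
  rw [← N.map_neg, neg_sub]

theorem q_neg (x : X) : N.q (-x) = N.q x := by rw [q, map_neg, q]

theorem q_sub_comm (x y : X) : N.q (x - y) = N.q (y - x) := by rw [q, map_sub_comm, q]

theorem q_sub_le (x y z : X) : N.q (x - z) ≤ N.q (x - y) + N.q (y - z) := by
  simpa using N.q_add_le (x - y) (y - z)

theorem q_le_add_sub (x y : X) : N.q x ≤ N.q y + N.q (x - y) := by
  simpa using N.q_add_le y (x - y)

theorem q_sum_le (hp : 0 < p) {ι : Type*} (s : Finset ι) (f : ι → X) :
    N.q (∑ i ∈ s, f i) ≤ ∑ i ∈ s, N.q (f i) := by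
  classical
  induction s using Finset.induction_on with
  | empty => simp [q, N.map_zero, Real.zero_rpow hp.ne']
  | insert i s hi ih =>
    rw [Finset.sum_insert hi, Finset.sum_insert hi]
    exact (N.q_add_le _ _).trans (by gcongr)

variable {N M}

section

variable (hp : 0 < p)
include hp

theorem q_zero : N.q 0 = 0 := by rw [q, map_zero, Real.zero_rpow hp.ne']

theorem q_eq_zero {x : X} : N.q x = 0 ↔ x = 0 := by
  rw [q, Real.rpow_eq_zero (N.nonneg' x) hp.ne', N.eq_zero_iff']

theorem q_le_q {x : X} {y : Y} : N.q x ≤ M.q y ↔ N x ≤ M y :=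
  Real.rpow_le_rpow_iff (N.nonneg' x) (M.nonneg' y) hp

theorem lt_iff_q_lt {x : X} {ε : ℝ} (hε : 0 < ε) : N x < ε ↔ N.q x < ε ^ p :=
  (Real.rpow_lt_rpow_iff (N.nonneg' x) hε.le hp).symm

theorem q_lt_iff {x : X} {ε : ℝ} (hε : 0 < ε) : N.q x < ε ↔ N x < ε ^ (1 / p) := by
  rw [lt_iff_q_lt hp (by positivity), ← Real.rpow_mul hε.le, one_div_mul_cancel hp.ne',
    Real.rpow_one]

end

/-- The metric `N (x - y) ^ p` given by a `p`-norm. -/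
noncomputable abbrev normedGroup (N : PNorm p 𝕜 X) (hp : 0 < p) : NormedAddCommGroup X :=
  AddGroupNorm.toNormedAddCommGroup
    { toFun := N.q
      map_zero' := q_zero hp
      add_le' := N.q_add_le
      neg' := N.q_neg
      eq_zero_of_map_eq_zero' := fun _ h => (q_eq_zero hp).1 h }

theorem IsComplete.exists_limit_of_geometric (hN : N.IsComplete) (hp : 0 < p) {s : ℕ → X} {C : ℝ}
    {n : ℕ} (h : ∀ m ≥ n, N.q (s (m + 1) - s m) ≤ C * (1 / 2) ^ m) :
    ∃ x, ∀ m ≥ n, N.q (s m - x) ≤ 2 * C * (1 / 2) ^ m := by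
  let _ := N.normedGroup hp
  have hnorm : ∀ x : X, ‖x‖ = N.q x := fun _ => rfl
  have hd : ∀ k, dist (s (n + k)) (s (n + (k + 1))) ≤ (2 * C * (1 / 2) ^ n) / 2 / 2 ^ k := by
    intro k
    rw [dist_eq_norm, hnorm, N.q_sub_comm]
    refine (h (n + k) (by omega)).trans (le_of_eq ?_)
    rw [pow_add, one_div_pow 2 k]
    ring
  have hc := cauchySeq_of_le_geometric_two hd
  obtain ⟨x, hx⟩ := hN (fun k => s (n + k)) (by
    intro ε hε
    obtain ⟨n₀, h₀⟩ := Metric.cauchySeq_iff.1 hc (ε ^ p) (by positivity)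
    refine ⟨n₀, fun k hk l hl => ?_⟩
    have := h₀ k hk l hl
    rw [dist_eq_norm, hnorm] at this
    exact (lt_iff_q_lt hp hε).2 this)
  have ht : Tendsto (fun k => s (n + k)) atTop (𝓝 x) := by
    rw [Metric.tendsto_atTop]
    intro ε hε
    obtain ⟨n₀, h₀⟩ := hx (ε ^ (1 / p)) (by positivity)
    refine ⟨n₀, fun k hk => ?_⟩
    rw [dist_eq_norm, hnorm]
    exact (q_lt_iff hp hε).2 (h₀ k hk)
  refine ⟨x, fun m hm => ?_⟩
  obtain ⟨k, rfl⟩ := Nat.exists_eq_add_of_le hm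
  have := dist_le_of_le_geometric_two_of_tendsto hd ht k
  rw [dist_eq_norm, hnorm] at this
  refine this.trans (le_of_eq ?_)
  rw [pow_add, one_div_pow 2 k]
  ring

theorem eq_of_forall_q_lt (hp : 0 < p) {x y : X} (h : ∀ ε > 0, N.q (x - y) < ε) : x = y := by
  have h0 : N.q (x - y) = 0 :=
    le_antisymm (le_of_forall_pos_lt_add fun ε hε => by simpa using h ε hε) (N.q_nonneg _)
  exact sub_eq_zero.1 ((q_eq_zero hp).1 h0)

/-- A contractive linear relation with dense domain and complete target extends to a contractive
linear map. -/
theorem exists_extension (hp : 0 < p) (hM : M.IsComplete) (G : Submodule 𝕜 (X × Y))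
    (hG : ∀ g ∈ G, M.q g.2 ≤ N.q g.1)
    (hd : ∀ (x : X) (ε : ℝ), 0 < ε → ∃ g ∈ G, N.q (x - g.1) < ε) :
    ∃ L : X →ₗ[𝕜] Y, (∀ x, M.q (L x) ≤ N.q x) ∧ ∀ g ∈ G, L g.1 = g.2 := by
  -- `R` is the closure of `G`. It is again linear and contractive; contractivity over `0` makes it
  -- single-valued, and completeness with density makes it total, so it is the graph of the
  -- extension.
  let R : X → Y → Prop := fun x y =>
    ∀ ε > 0, ∃ g ∈ G, N.q (x - g.1) < ε ∧ M.q (y - g.2) < ε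
  have hR0 : ∀ {x y}, R x y → M.q y ≤ N.q x := by
    intro x y h
    refine le_of_forall_pos_lt_add fun ε hε => ?_
    obtain ⟨g, hg, h1, h2⟩ := h (ε / 2) (by positivity)
    have h3 := M.q_le_add_sub y g.2
    have h4 := N.q_le_add_sub g.1 x
    rw [N.q_sub_comm] at h4
    linarith [hG g hg]
  have hRadd : ∀ {x y x' y'}, R x y → R x' y' → R (x + x') (y + y') := by
    intro x y x' y' h h' ε hε
    obtain ⟨g, hg, h1, h2⟩ := h (ε / 2) (by positivity)
    obtain ⟨g', hg', h1', h2'⟩ := h' (ε / 2) (by positivity)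
    refine ⟨g + g', G.add_mem hg hg', ?_, ?_⟩
    · have := N.q_add_le (x - g.1) (x' - g'.1)
      rw [sub_add_sub_comm] at this
      exact this.trans_lt (by linarith)
    · have := M.q_add_le (y - g.2) (y' - g'.2)
      rw [sub_add_sub_comm] at this
      exact this.trans_lt (by linarith)
  have hRsmul : ∀ (c : 𝕜) {x y}, R x y → R (c • x) (c • y) := by
    intro c x y h ε hε
    have hc : 0 < ‖c‖ ^ p + 1 := by positivity
    obtain ⟨g, hg, h1, h2⟩ := h (ε / (‖c‖ ^ p + 1)) (by positivity)
    rw [lt_div_iff₀ hc] at h1 h2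
    refine ⟨c • g, G.smul_mem c hg, ?_, ?_⟩
    · rw [Prod.smul_fst, ← smul_sub, q_smul]
      nlinarith [N.q_nonneg (x - g.1)]
    · rw [Prod.smul_snd, ← smul_sub, q_smul]
      nlinarith [M.q_nonneg (y - g.2)]
  have huniq : ∀ {x y y'}, R x y → R x y' → y = y' := by
    intro x y y' h h'
    have h1 := hR0 (hRadd h (hRsmul (-1) h'))
    rw [neg_one_smul, neg_one_smul, add_neg_cancel, q_zero hp, ← sub_eq_add_neg] at h1
    exact sub_eq_zero.1 ((q_eq_zero hp).1 (le_antisymm h1 (M.q_nonneg _)))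
  have htot : ∀ x, ∃ y, R x y := by
    intro x
    choose g hg hgx using fun n : ℕ => hd x ((1 / 2) ^ n) (by positivity)
    -- Consecutive terms differ by less than `(1/2)^(m+1) + (1/2)^m`, hence `C = 2`; the limit is
    -- then within `4 (1/2)^n`, which explains `ε / 4` below.
    obtain ⟨y, hy⟩ := hM.exists_limit_of_geometric hp (s := fun n => (g n).2) (C := 2) (n := 0) (by
      intro m _
      have h1 := hG _ (G.sub_mem (hg (m + 1)) (hg m))
      have h2 := N.q_sub_le (g (m + 1)).1 x (g m).1
      have h3 := hgx m
      have h4 := hgx (m + 1)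
      rw [N.q_sub_comm] at h4
      rw [pow_succ] at h4
      rw [Prod.fst_sub, Prod.snd_sub] at h1
      have : (0 : ℝ) < (1 / 2) ^ m := by positivity
      linarith)
    refine ⟨y, fun ε hε => ?_⟩
    obtain ⟨n, hn⟩ := exists_pow_lt_of_lt_one (show 0 < ε / 4 by positivity)
      (show (1 / 2 : ℝ) < 1 by norm_num)
    refine ⟨g n, hg n, (hgx n).trans (by linarith), ?_⟩
    rw [M.q_sub_comm]
    have := hy n (by omega)
    linarith
  choose L hL using htot
  refine ⟨{ toFun := L
            map_add' := fun x y => huniq (hL _) (hRadd (hL x) (hL y))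
            map_smul' := fun c x => huniq (hL _) (hRsmul c (hL x)) }, fun x => hR0 (hL x), ?_⟩
  intro g hg
  refine huniq (hL _) fun ε hε => ⟨g, hg, ?_, ?_⟩
  · rwa [sub_self, q_zero hp]
  · rwa [sub_self, q_zero hp]

/-! ### Comparison with the sup norm on coordinate spaces -/

section FiniteDimensional

variable {d : ℕ} (N : PNorm p 𝕜 (Fin d → 𝕜))

theorem exists_q_le_norm_rpow (hp : 0 < p) : ∃ C > 0, ∀ x : Fin d → 𝕜, N.q x ≤ C * ‖x‖ ^ p := by
  -- The summand `1` keeps the constant positive when `d = 0`.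
  refine ⟨∑ i, N.q (Pi.single i 1) + 1, ?_, fun x => ?_⟩
  · have : 0 ≤ ∑ i, N.q (Pi.single i (1 : 𝕜)) := Finset.sum_nonneg fun i _ => N.q_nonneg _
    linarith
  · have hx : x = ∑ i, x i • (Pi.single i 1 : Fin d → 𝕜) := by
      ext j
      simp [Finset.sum_apply, Pi.single_apply]
    have h1 : N.q x ≤ ∑ i, N.q (x i • (Pi.single i 1 : Fin d → 𝕜)) := by
      conv_lhs => rw [hx]
      exact N.q_sum_le hp _ _
    have h2 : ∑ i, N.q (x i • (Pi.single i 1 : Fin d → 𝕜)) ≤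
        ∑ i, N.q (Pi.single i 1 : Fin d → 𝕜) * ‖x‖ ^ p := by
      refine Finset.sum_le_sum fun i _ => ?_
      rw [q_smul, mul_comm]
      exact mul_le_mul_of_nonneg_left
        (Real.rpow_le_rpow (norm_nonneg _) (norm_le_pi_norm x i) hp.le) (N.q_nonneg _)
    rw [← Finset.sum_mul] at h2
    have : 0 ≤ ‖x‖ ^ p := by positivity
    linarith

theorem continuous_q (hp : 0 < p) : Continuous N.q := by
  obtain ⟨C, hC, h⟩ := N.exists_q_le_norm_rpow hp
  rw [continuous_iff_continuousAt]
  intro x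
  have ht : Tendsto (fun y : Fin d → 𝕜 => C * ‖y - x‖ ^ p) (𝓝 x) (𝓝 0) := by
    have : Continuous fun y : Fin d → 𝕜 => C * ‖y - x‖ ^ p :=
      continuous_const.mul ((continuous_id.sub continuous_const).norm.rpow_const
        fun _ => Or.inr hp.le)
    simpa [Real.zero_rpow hp.ne'] using this.tendsto x
  rw [ContinuousAt, tendsto_iff_dist_tendsto_zero]
  refine squeeze_zero (fun _ => dist_nonneg) (fun y => ?_) ht
  rw [Real.dist_eq, abs_le]
  have h1 := N.q_le_add_sub y x
  have h2 := N.q_le_add_sub x y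
  rw [N.q_sub_comm] at h2
  constructor <;> linarith [h (y - x)]

/-- By continuity, `N.q` attains a positive minimum on the compact unit sphere; the rest is
homogeneity. An empty sphere means that the space is zero. -/
theorem exists_norm_rpow_le_q (hp : 0 < p) : ∃ C > 0, ∀ x : Fin d → 𝕜, ‖x‖ ^ p ≤ C * N.q x := by
  rcases (Metric.sphere (0 : Fin d → 𝕜) 1).eq_empty_or_nonempty with he | hne
  · refine ⟨1, one_pos, fun x => ?_⟩
    by_cases hx : x = 0
    · simp [hx, Real.zero_rpow hp.ne', N.q_nonneg]
    · exfalso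
      have : ((‖x‖⁻¹ : ℝ) : 𝕜) • x ∈ Metric.sphere (0 : Fin d → 𝕜) 1 := by
        rw [mem_sphere_zero_iff_norm, norm_smul, RCLike.norm_ofReal, abs_inv, abs_norm,
          inv_mul_cancel₀ (norm_ne_zero_iff.2 hx)]
      rw [he] at this
      exact this
  · obtain ⟨z, hz, hmin⟩ := (isCompact_sphere (0 : Fin d → 𝕜) 1).exists_isMinOn hne
      (N.continuous_q hp).continuousOn
    have hz0 : z ≠ 0 := by
      rintro rfl
      simp at hz
    have hqz : 0 < N.q z := lt_of_le_of_ne (N.q_nonneg z) fun h => hz0 ((q_eq_zero hp).1 h.symm)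
    refine ⟨(N.q z)⁻¹, by positivity, fun x => ?_⟩
    by_cases hx : x = 0
    · simp [hx, Real.zero_rpow hp.ne', q_zero hp]
    · have hm : ((‖x‖⁻¹ : ℝ) : 𝕜) • x ∈ Metric.sphere (0 : Fin d → 𝕜) 1 := by
        rw [mem_sphere_zero_iff_norm, norm_smul, RCLike.norm_ofReal, abs_inv, abs_norm,
          inv_mul_cancel₀ (norm_ne_zero_iff.2 hx)]
      have h1 : N.q z ≤ N.q (((‖x‖⁻¹ : ℝ) : 𝕜) • x) := hmin hm
      rw [q_smul, RCLike.norm_ofReal, abs_inv, abs_norm, Real.inv_rpow (norm_nonneg _)] at h1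
      have hxp : 0 < ‖x‖ ^ p := Real.rpow_pos_of_pos (norm_pos_iff.2 hx) p
      rw [inv_mul_eq_div, le_div_iff₀ hxp] at h1
      rw [inv_mul_eq_div, le_div_iff₀ hqz]
      linarith

theorem isComplete_of_fin (hp : 0 < p) : N.IsComplete := by
  intro s hs
  obtain ⟨C, hC, hCle⟩ := N.exists_q_le_norm_rpow hp
  obtain ⟨D, hD, hDle⟩ := N.exists_norm_rpow_le_q hp
  have hcau : CauchySeq s := by
    rw [Metric.cauchySeq_iff]
    intro ε hε
    obtain ⟨n, hn⟩ := hs ((ε ^ p / D) ^ (1 / p)) (by positivity)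
    refine ⟨n, fun k hk l hl => ?_⟩
    have h1 := (q_lt_iff hp (by positivity)).2 (hn k hk l hl)
    rw [lt_div_iff₀ hD] at h1
    rw [dist_eq_norm, ← Real.rpow_lt_rpow_iff (norm_nonneg _) hε.le hp]
    linarith [hDle (s k - s l)]
  obtain ⟨x, hx⟩ := cauchySeq_tendsto_of_complete hcau
  refine ⟨x, fun ε hε => ?_⟩
  obtain ⟨n, hn⟩ := Metric.tendsto_atTop.1 hx ((ε ^ p / C) ^ (1 / p)) (by positivity)
  refine ⟨n, fun k hk => ?_⟩
  have h1 := hn k hk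
  rw [dist_eq_norm, ← Real.rpow_lt_rpow_iff (norm_nonneg _) (by positivity) hp,
    ← Real.rpow_mul (by positivity), one_div_mul_cancel hp.ne', Real.rpow_one,
    lt_div_iff₀ hC] at h1
  rw [lt_iff_q_lt hp hε]
  linarith [hCle (s k - x)]

end FiniteDimensional

end PNorm

/-! ### Rational scalars, points and maps -/

section Rational

variable {𝕜 : Type*} [RCLike 𝕜]

theorem RCLike.norm_I_le_one : ‖(RCLike.I : 𝕜)‖ ≤ 1 := by
  by_cases h : (RCLike.I : 𝕜) = 0
  · simp [h]
  · exact (RCLike.norm_I_of_ne_zero h).le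

theorem RCLike.im_I_eq : RCLike.im (RCLike.I : 𝕜) = 0 ∨ RCLike.im (RCLike.I : 𝕜) = 1 := by
  have h := RCLike.I_im (RCLike.I : 𝕜)
  by_cases h0 : RCLike.im (RCLike.I : 𝕜) = 0
  · exact Or.inl h0
  · exact Or.inr (mul_left_cancel₀ h0 (by rw [h, mul_one]))

variable (𝕜) in
/-- The scalars with rational real and imaginary parts. -/
def rationalSubfield : Subfield 𝕜 where
  carrier := {x | ∃ a b : ℚ, RCLike.re x = a ∧ RCLike.im x = b}
  zero_mem' := ⟨0, 0, by simp, by simp⟩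
  one_mem' := ⟨1, 0, by simp, by simp⟩
  add_mem' := by
    rintro x y ⟨a, b, h1, h2⟩ ⟨c, d, h3, h4⟩
    exact ⟨a + c, b + d, by simp [h1, h3], by simp [h2, h4]⟩
  neg_mem' := by
    rintro x ⟨a, b, h1, h2⟩
    exact ⟨-a, -b, by simp [h1], by simp [h2]⟩
  mul_mem' := by
    rintro x y ⟨a, b, h1, h2⟩ ⟨c, d, h3, h4⟩
    exact ⟨a * c - b * d, a * d + b * c, by simp [RCLike.mul_re, h1, h2, h3, h4],
      by simp [RCLike.mul_im, h1, h2, h3, h4]⟩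
  inv_mem' := by
    rintro x ⟨a, b, h1, h2⟩
    exact ⟨a / (a * a + b * b), -b / (a * a + b * b),
      by simp [RCLike.inv_re, RCLike.normSq_apply, h1, h2],
      by simp [RCLike.inv_im, RCLike.normSq_apply, h1, h2]⟩

theorem mem_rationalSubfield_iff {x : 𝕜} :
    x ∈ rationalSubfield 𝕜 ↔ ∃ a b : ℚ, x = (a : 𝕜) + (b : 𝕜) * RCLike.I := by
  constructor
  · rintro ⟨a, b, h1, h2⟩
    refine ⟨a, b, ?_⟩
    rw [← RCLike.re_add_im x, h1, h2]
    simp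
  · rintro ⟨a, b, rfl⟩
    have ha : ∀ c : ℚ, (c : 𝕜) ∈ rationalSubfield 𝕜 := fun c => ⟨c, 0, by simp, by simp⟩
    refine add_mem (ha a) (mul_mem (ha b) ?_)
    rcases RCLike.im_I_eq (𝕜 := 𝕜) with h | h
    · exact ⟨0, 0, by simp, by simp [h]⟩
    · exact ⟨0, 1, by simp, by simp [h]⟩

instance : Countable (rationalSubfield 𝕜) := by
  have h : (Set.range fun t : ℚ × ℚ => (t.1 : 𝕜) + (t.2 : 𝕜) * RCLike.I).Countable :=
    Set.countable_range _
  refine (h.mono ?_).to_subtype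
  intro x hx
  obtain ⟨a, b, rfl⟩ := mem_rationalSubfield_iff.1 hx
  exact ⟨(a, b), rfl⟩

theorem exists_mem_rationalSubfield_norm_sub_lt (z : 𝕜) {δ : ℝ} (hδ : 0 < δ) :
    ∃ r ∈ rationalSubfield 𝕜, ‖z - r‖ < δ := by
  obtain ⟨a, ha⟩ := exists_rat_near (RCLike.re z) (half_pos hδ)
  obtain ⟨b, hb⟩ := exists_rat_near (RCLike.im z) (half_pos hδ)
  refine ⟨(a : 𝕜) + (b : 𝕜) * RCLike.I, mem_rationalSubfield_iff.2 ⟨a, b, rfl⟩, ?_⟩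
  have h : z - ((a : 𝕜) + (b : 𝕜) * RCLike.I) =
      ((RCLike.re z - a : ℝ) : 𝕜) + ((RCLike.im z - b : ℝ) : 𝕜) * RCLike.I := by
    conv_lhs => rw [← RCLike.re_add_im z]
    push_cast
    ring
  rw [h]
  refine (norm_add_le _ _).trans_lt ?_
  rw [norm_mul, RCLike.norm_ofReal, RCLike.norm_ofReal]
  have := mul_le_mul_of_nonneg_left (RCLike.norm_I_le_one (𝕜 := 𝕜)) (abs_nonneg (RCLike.im z - b))
  linarith

variable {n m l : ℕ}

theorem isRationalPoint_iff {x : Fin n → 𝕜} :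
    IsRationalPoint x ↔ ∀ i, x i ∈ rationalSubfield 𝕜 :=
  forall_congr' fun _ => mem_rationalSubfield_iff.symm

theorem IsRationalPoint.zero : IsRationalPoint (0 : Fin n → 𝕜) :=
  isRationalPoint_iff.2 fun _ => zero_mem _

theorem IsRationalPoint.single {i : Fin n} {c : 𝕜} (hc : c ∈ rationalSubfield 𝕜) :
    IsRationalPoint (Pi.single i c) := by
  refine isRationalPoint_iff.2 fun j => ?_
  by_cases h : j = i
  · subst h; simpa using hc
  · rw [Pi.single_eq_of_ne h]
    exact zero_mem _

theorem IsRationalPoint.add {x y : Fin n → 𝕜} (hx : IsRationalPoint x) (hy : IsRationalPoint y) :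
    IsRationalPoint (x + y) :=
  isRationalPoint_iff.2 fun i => add_mem (isRationalPoint_iff.1 hx i) (isRationalPoint_iff.1 hy i)

theorem IsRationalPoint.sub {x y : Fin n → 𝕜} (hx : IsRationalPoint x) (hy : IsRationalPoint y) :
    IsRationalPoint (x - y) :=
  isRationalPoint_iff.2 fun i => sub_mem (isRationalPoint_iff.1 hx i) (isRationalPoint_iff.1 hy i)

theorem IsRationalPoint.append {x : Fin n → 𝕜} {y : Fin m → 𝕜} (hx : IsRationalPoint x)
    (hy : IsRationalPoint y) : IsRationalPoint (Fin.append x y) := by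
  intro i
  induction i using Fin.addCases with
  | left i => simpa using hx i
  | right i => simpa using hy i

theorem IsRationalMap.id : IsRationalMap (LinearMap.id : (Fin n → 𝕜) →ₗ[𝕜] (Fin n → 𝕜)) :=
  fun _ h => h

theorem IsRationalMap.zero : IsRationalMap (0 : (Fin n → 𝕜) →ₗ[𝕜] (Fin m → 𝕜)) :=
  fun _ _ => IsRationalPoint.zero

theorem IsRationalMap.comp {f : (Fin m → 𝕜) →ₗ[𝕜] (Fin l → 𝕜)} {g : (Fin n → 𝕜) →ₗ[𝕜] (Fin m → 𝕜)}
    (hf : IsRationalMap f) (hg : IsRationalMap g) : IsRationalMap (f ∘ₗ g) :=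
  fun x hx => hf _ (hg x hx)

theorem IsRationalMap.add {f g : (Fin n → 𝕜) →ₗ[𝕜] (Fin m → 𝕜)}
    (hf : IsRationalMap f) (hg : IsRationalMap g) : IsRationalMap (f + g) :=
  fun x hx => (hf x hx).add (hg x hx)

theorem IsRationalMap.sub {f g : (Fin n → 𝕜) →ₗ[𝕜] (Fin m → 𝕜)}
    (hf : IsRationalMap f) (hg : IsRationalMap g) : IsRationalMap (f - g) :=
  fun x hx => (hf x hx).sub (hg x hx)

/-- The linear map with components `f` and `g`. -/
def appendMap {V : Type*} [AddCommGroup V] [Module 𝕜 V] (f : V →ₗ[𝕜] (Fin n → 𝕜))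
    (g : V →ₗ[𝕜] (Fin m → 𝕜)) : V →ₗ[𝕜] (Fin (n + m) → 𝕜) where
  toFun x := Fin.append (f x) (g x)
  map_add' x y := by
    ext i
    induction i using Fin.addCases <;> simp
  map_smul' c x := by
    ext i
    induction i using Fin.addCases <;> simp

@[simp]
theorem appendMap_apply {V : Type*} [AddCommGroup V] [Module 𝕜 V] (f : V →ₗ[𝕜] (Fin n → 𝕜))
    (g : V →ₗ[𝕜] (Fin m → 𝕜)) (x : V) : appendMap f g x = Fin.append (f x) (g x) := rfl

variable (𝕜 n m) in
/-- The projection of `𝕜ⁿ⁺ᵐ` onto the first `n` coordinates. -/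
def leftMap : (Fin (n + m) → 𝕜) →ₗ[𝕜] (Fin n → 𝕜) := LinearMap.funLeft 𝕜 𝕜 (Fin.castAdd m)

variable (𝕜 n m) in
/-- The projection of `𝕜ⁿ⁺ᵐ` onto the last `m` coordinates. -/
def rightMap : (Fin (n + m) → 𝕜) →ₗ[𝕜] (Fin m → 𝕜) := LinearMap.funLeft 𝕜 𝕜 (Fin.natAdd n)

@[simp]
theorem leftMap_append (x : Fin n → 𝕜) (y : Fin m → 𝕜) : leftMap 𝕜 n m (Fin.append x y) = x := by
  ext i; simp [leftMap, LinearMap.funLeft_apply]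

@[simp]
theorem rightMap_append (x : Fin n → 𝕜) (y : Fin m → 𝕜) : rightMap 𝕜 n m (Fin.append x y) = y := by
  ext i; simp [rightMap, LinearMap.funLeft_apply]

theorem append_left_right (z : Fin (n + m) → 𝕜) :
    Fin.append (leftMap 𝕜 n m z) (rightMap 𝕜 n m z) = z := by
  ext i
  induction i using Fin.addCases <;> simp [leftMap, rightMap, LinearMap.funLeft_apply]

theorem IsRationalMap.leftMap : IsRationalMap (leftMap 𝕜 n m) := fun _ hx _ => hx _

theorem IsRationalMap.rightMap : IsRationalMap (rightMap 𝕜 n m) := fun _ hx _ => hx _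

theorem IsRationalMap.appendMap {f : (Fin l → 𝕜) →ₗ[𝕜] (Fin n → 𝕜)}
    {g : (Fin l → 𝕜) →ₗ[𝕜] (Fin m → 𝕜)} (hf : IsRationalMap f) (hg : IsRationalMap g) :
    IsRationalMap (appendMap f g) :=
  fun x hx => (hf x hx).append (hg x hx)

theorem IsRationalMap.toMatrix'_mem {f : (Fin n → 𝕜) →ₗ[𝕜] (Fin m → 𝕜)} (hf : IsRationalMap f)
    (i : Fin m) (j : Fin n) : LinearMap.toMatrix' f i j ∈ rationalSubfield 𝕜 := by
  rw [LinearMap.toMatrix'_apply]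
  exact isRationalPoint_iff.1 (hf _ (IsRationalPoint.single (one_mem _))) i

theorem isRationalMap_toLin' {A : Matrix (Fin m) (Fin n) 𝕜}
    (hA : ∀ i j, A i j ∈ rationalSubfield 𝕜) : IsRationalMap (Matrix.toLin' A) := by
  intro x hx
  rw [isRationalPoint_iff] at hx ⊢
  intro i
  rw [Matrix.toLin'_apply]
  change ∑ j, A i j * x j ∈ _
  exact sum_mem fun j _ => mul_mem (hA i j) (hx j)

/-- The matrix of a rational map. -/
noncomputable def IsRationalMap.matrix {f : (Fin n → 𝕜) →ₗ[𝕜] (Fin m → 𝕜)} (hf : IsRationalMap f) :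
    Matrix (Fin m) (Fin n) (rationalSubfield 𝕜) :=
  fun i j => ⟨LinearMap.toMatrix' f i j, hf.toMatrix'_mem i j⟩

theorem IsRationalMap.matrix_map {f : (Fin n → 𝕜) →ₗ[𝕜] (Fin m → 𝕜)} (hf : IsRationalMap f) :
    hf.matrix.map (rationalSubfield 𝕜).subtype = LinearMap.toMatrix' f := rfl

instance : Countable {f : (Fin n → 𝕜) →ₗ[𝕜] (Fin m → 𝕜) // IsRationalMap f} := by
  have : Countable (Matrix (Fin m) (Fin n) (rationalSubfield 𝕜)) :=
    inferInstanceAs (Countable (Fin m → Fin n → rationalSubfield 𝕜))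
  refine Function.Injective.countable (f := fun f => f.2.matrix) fun f g h => ?_
  apply Subtype.ext
  apply LinearMap.toMatrix'.injective
  rw [← f.2.matrix_map, ← g.2.matrix_map]
  exact congrArg (fun A => A.map (rationalSubfield 𝕜).subtype) h

instance : Countable {x : Fin n → 𝕜 // IsRationalPoint x} := by
  refine Function.Injective.countable
    (f := fun x i => (⟨x.1 i, isRationalPoint_iff.1 x.2 i⟩ : rationalSubfield 𝕜)) fun x y h => ?_
  apply Subtype.ext
  funext i
  exact congrArg Subtype.val (congrFun h i)

/-- A rational idempotent splits through a coordinate space. -/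
theorem IsRationalMap.exists_splitting {Q : (Fin n → 𝕜) →ₗ[𝕜] (Fin n → 𝕜)} (hQ : IsRationalMap Q)
    (hQQ : Q ∘ₗ Q = Q) :
    ∃ (d : ℕ) (j : (Fin d → 𝕜) →ₗ[𝕜] (Fin n → 𝕜)) (r : (Fin n → 𝕜) →ₗ[𝕜] (Fin d → 𝕜)),
      IsRationalMap j ∧ IsRationalMap r ∧ r ∘ₗ j = LinearMap.id ∧ j ∘ₗ r = Q := by
  -- The splitting is done over the field of rational scalars, where the range of the matrix has a
  -- basis; extension of scalars then gives `j` and `r` with rational entries.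
  let k := rationalSubfield 𝕜
  let σ : k →+* 𝕜 := k.subtype
  have hσi : Function.Injective σ := Subtype.val_injective
  have hmul : hQ.matrix * hQ.matrix = hQ.matrix := by
    apply Matrix.map_injective hσi
    change (hQ.matrix * hQ.matrix).map σ = hQ.matrix.map σ
    rw [Matrix.map_mul, hQ.matrix_map, ← LinearMap.toMatrix'_comp, hQQ]
  set L := Matrix.toLin' hQ.matrix with hL
  have hLL : ∀ x, L (L x) = L x := by
    intro x
    rw [← LinearMap.comp_apply, hL, ← Matrix.toLin'_mul, hmul]
  let e := (Module.finBasis k (LinearMap.range L)).equivFun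
  let j₀ := (LinearMap.range L).subtype ∘ₗ e.symm.toLinearMap
  let r₀ := e.toLinearMap ∘ₗ L.rangeRestrict
  have hrj : r₀ ∘ₗ j₀ = LinearMap.id := by
    refine LinearMap.ext fun x => ?_
    have : L.rangeRestrict (e.symm x : Fin n → k) = e.symm x := by
      obtain ⟨y, hy⟩ := (e.symm x).2
      apply Subtype.ext
      change L _ = _
      rw [← hy, hLL]
    change e (L.rangeRestrict (e.symm x : Fin n → k)) = x
    rw [this, e.apply_symm_apply]
  have hjr : j₀ ∘ₗ r₀ = L := by
    refine LinearMap.ext fun x => ?_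
    change ((e.symm (e (L.rangeRestrict x)) : LinearMap.range L) : Fin n → k) = L x
    rw [e.symm_apply_apply]
    rfl
  refine ⟨Module.finrank k (LinearMap.range L), Matrix.toLin' ((LinearMap.toMatrix' j₀).map σ),
    Matrix.toLin' ((LinearMap.toMatrix' r₀).map σ),
    isRationalMap_toLin' fun _ _ => Subtype.property _,
    isRationalMap_toLin' fun _ _ => Subtype.property _, ?_, ?_⟩
  · rw [← Matrix.toLin'_mul, ← Matrix.map_mul, ← LinearMap.toMatrix'_comp, hrj,
      LinearMap.toMatrix'_id, Matrix.map_one _ (map_zero σ) (map_one σ), Matrix.toLin'_one]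
  · rw [← Matrix.toLin'_mul, ← Matrix.map_mul, ← LinearMap.toMatrix'_comp, hjr, hL,
      LinearMap.toMatrix'_toLin', hQ.matrix_map, Matrix.toLin'_toMatrix']

theorem exists_isRationalMap_norm_sub_le (T : (Fin n → 𝕜) →ₗ[𝕜] (Fin m → 𝕜)) {δ : ℝ}
    (hδ : 0 < δ) : ∃ f, IsRationalMap f ∧ ∀ x, ‖f x - T x‖ ≤ δ * ‖x‖ := by
  have hn : (0 : ℝ) < n + 1 := by positivity
  choose A hA hAδ using fun i j =>
    exists_mem_rationalSubfield_norm_sub_lt (LinearMap.toMatrix' T i j)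
      (show 0 < δ / (n + 1) by positivity)
  refine ⟨Matrix.toLin' (Matrix.of A), isRationalMap_toLin' hA, fun x => ?_⟩
  rw [pi_norm_le_iff_of_nonneg (by positivity)]
  intro i
  have h : (Matrix.toLin' (Matrix.of A) x - T x) i =
      ∑ j, (A i j - LinearMap.toMatrix' T i j) * x j := by
    have hT : T x i = ∑ j, LinearMap.toMatrix' T i j * x j := by
      conv_lhs => rw [← Matrix.toLin'_toMatrix' T]
      rfl
    simp only [Pi.sub_apply, hT]
    simp [Matrix.mulVec, dotProduct, sub_mul, Finset.sum_sub_distrib, Matrix.toLin'_apply]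
  rw [h]
  calc _ ≤ ∑ j : Fin n, δ / (n + 1) * ‖x‖ := by
        refine norm_sum_le_of_le _ fun j _ => ?_
        rw [norm_mul, norm_sub_rev]
        gcongr
        · exact (hAδ i j).le
        · exact norm_le_pi_norm x j
    _ ≤ δ * ‖x‖ := by
        rw [Finset.sum_const, Finset.card_univ, Fintype.card_fin, nsmul_eq_mul, ← mul_assoc]
        refine mul_le_mul_of_nonneg_right ?_ (norm_nonneg x)
        rw [← mul_div_assoc, div_le_iff₀ hn]
        nlinarith

theorem exists_isRationalPoint_norm_sub_lt (x : Fin n → 𝕜) {δ : ℝ} (hδ : 0 < δ) :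
    ∃ y, IsRationalPoint y ∧ ‖x - y‖ < δ := by
  choose y hy hyδ using fun i => exists_mem_rationalSubfield_norm_sub_lt (x i) hδ
  exact ⟨y, isRationalPoint_iff.2 hy, (pi_norm_lt_iff hδ).2 hyδ⟩

end Rational

/-! ### Pullbacks and max-products of `p`-norms -/

namespace PNorm

variable {p : ℝ} {𝕜 : Type*} [RCLike 𝕜] {X : Type*} [AddCommGroup X] [Module 𝕜 X]
  {Y : Type*} [AddCommGroup Y] [Module 𝕜 Y]

/-- The `p`-norm pulled back along an injective linear map. -/
def comap (N : PNorm p 𝕜 Y) (f : X →ₗ[𝕜] Y) (hf : Function.Injective f) : PNorm p 𝕜 X where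
  toFun x := N (f x)
  nonneg' x := N.nonneg' _
  eq_zero_iff' x := by rw [N.eq_zero_iff', map_eq_zero_iff f hf]
  smul' c x := by rw [map_smul, N.smul']
  add_rpow_le' x y := by rw [map_add]; exact N.add_rpow_le' _ _

theorem max_rpow_le (hp : 0 < p) {a b a₁ a₂ b₁ b₂ : ℝ} (ha₁ : 0 ≤ a₁) (ha₂ : 0 ≤ a₂)
    (h₁ : a ^ p ≤ a₁ ^ p + a₂ ^ p) (h₂ : b ^ p ≤ b₁ ^ p + b₂ ^ p)
    (hb₁ : 0 ≤ b₁) (hb₂ : 0 ≤ b₂) : max a b ^ p ≤ max a₁ b₁ ^ p + max a₂ b₂ ^ p := by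
  have h3 := Real.rpow_le_rpow ha₁ (le_max_left a₁ b₁) hp.le
  have h4 := Real.rpow_le_rpow ha₂ (le_max_left a₂ b₂) hp.le
  have h5 := Real.rpow_le_rpow hb₁ (le_max_right a₁ b₁) hp.le
  have h6 := Real.rpow_le_rpow hb₂ (le_max_right a₂ b₂) hp.le
  rcases max_choice a b with h | h <;> rw [h] <;> linarith

/-- The maximum of two `p`-norms on the product space. -/
noncomputable def prod (hp : 0 < p) {n m : ℕ} (N : PNorm p 𝕜 (Fin n → 𝕜))
    (M : PNorm p 𝕜 (Fin m → 𝕜)) : PNorm p 𝕜 (Fin (n + m) → 𝕜) where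
  toFun z := max (N (leftMap 𝕜 n m z)) (M (rightMap 𝕜 n m z))
  nonneg' z := le_max_of_le_left (N.nonneg' _)
  eq_zero_iff' z := by
    constructor
    · intro h
      have h1 := le_max_left (N (leftMap 𝕜 n m z)) (M (rightMap 𝕜 n m z))
      have h2 := le_max_right (N (leftMap 𝕜 n m z)) (M (rightMap 𝕜 n m z))
      rw [h] at h1 h2
      have h3 := (N.eq_zero_iff' _).1 (le_antisymm h1 (N.nonneg' _))
      have h4 := (M.eq_zero_iff' _).1 (le_antisymm h2 (M.nonneg' _))
      rw [← append_left_right z, h3, h4]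
      ext i
      induction i using Fin.addCases <;> simp
    · rintro rfl
      rw [_root_.map_zero, _root_.map_zero, N.map_zero, M.map_zero, max_self]
  smul' c z := by
    rw [map_smul, map_smul, N.smul', M.smul', mul_max_of_nonneg _ _ (norm_nonneg c)]
  add_rpow_le' x y := by
    rw [map_add, map_add]
    exact max_rpow_le hp (N.nonneg' _) (N.nonneg' _)
      (N.add_rpow_le' _ _) (M.add_rpow_le' _ _) (M.nonneg' _) (M.nonneg' _)

@[simp]
theorem prod_append (hp : 0 < p) {n m : ℕ} (N : PNorm p 𝕜 (Fin n → 𝕜))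
    (M : PNorm p 𝕜 (Fin m → 𝕜)) (x : Fin n → 𝕜) (y : Fin m → 𝕜) :
    N.prod hp M (Fin.append x y) = max (N x) (M y) := by
  change max (N (leftMap 𝕜 n m _)) (M (rightMap 𝕜 n m _)) = _
  rw [leftMap_append, rightMap_append]

theorem left_le_prod (hp : 0 < p) {n m : ℕ} (N : PNorm p 𝕜 (Fin n → 𝕜))
    (M : PNorm p 𝕜 (Fin m → 𝕜)) (z : Fin (n + m) → 𝕜) : N (leftMap 𝕜 n m z) ≤ N.prod hp M z :=
  le_max_left _ _

theorem right_le_prod (hp : 0 < p) {n m : ℕ} (N : PNorm p 𝕜 (Fin n → 𝕜))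
    (M : PNorm p 𝕜 (Fin m → 𝕜)) (z : Fin (n + m) → 𝕜) : M (rightMap 𝕜 n m z) ≤ N.prod hp M z :=
  le_max_right _ _

/-- The `p`-norm of the zero space. -/
def ofDimZero (p : ℝ) (𝕜 : Type*) [RCLike 𝕜] : PNorm p 𝕜 (Fin 0 → 𝕜) where
  toFun _ := 0
  nonneg' _ := le_rfl
  eq_zero_iff' x := by simp [Subsingleton.elim x 0]
  smul' _ _ := by simp
  add_rpow_le' _ _ := by
    rcases eq_or_ne p 0 with rfl | h
    · simp
    · simp [Real.zero_rpow h]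

theorem ofDimZero_isRational (hp : 0 < p) : (ofDimZero p 𝕜).IsRational := by
  refine ⟨0, fun i => i.elim0, fun i => i.elim0, fun x => ?_⟩
  have : {r : ℝ | ∃ c : Fin 0 → 𝕜, x = ∑ i, c i • (i.elim0 : Fin 0 → 𝕜) ∧
      r = (∑ i, ‖c i‖ ^ p) ^ (1 / p)} = {0} := by
    ext r
    simp [Subsingleton.elim x 0, Real.zero_rpow (inv_ne_zero hp.ne')]
  rw [this]
  exact isGLB_singleton

end PNorm

/-! ### Countability of allowed spaces and pairs -/

theorem Set.countable_setOf_exists_of_functional {α β : Type*} [Countable α] (R : α → β → Prop)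
    (hR : ∀ a b b', R a b → R a b' → b = b') : {b | ∃ a, R a b}.Countable := by
  rw [Set.ofPred_exists]
  exact Set.countable_iUnion fun a => Set.Subsingleton.countable fun b hb b' hb' => hR a b b' hb hb'

section Countable

variable {p : ℝ} {𝕜 : Type*} [RCLike 𝕜]

variable (p 𝕜) in
/-- Coordinate spaces with a `p`-norm. -/
abbrev CoordSpace := Σ n : ℕ, PNorm p 𝕜 (Fin n → 𝕜)

/-- A relation that pins the dimension and all values of the `p`-norm is functional. -/
theorem CoordSpace.eq_of_isGLB {n : ℕ} {S : (Fin n → 𝕜) → Set ℝ} {P P' : CoordSpace p 𝕜}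
    (h : ∃ N : PNorm p 𝕜 (Fin n → 𝕜), P = ⟨n, N⟩ ∧ ∀ x, IsGLB (S x) (N x))
    (h' : ∃ N : PNorm p 𝕜 (Fin n → 𝕜), P' = ⟨n, N⟩ ∧ ∀ x, IsGLB (S x) (N x)) : P = P' := by
  obtain ⟨N, rfl, hN⟩ := h
  obtain ⟨N', rfl, hN'⟩ := h'
  rw [PNorm.ext_apply fun x => (hN x).unique (hN' x)]

/-- The rational spaces. -/
def rationalSpaces (p : ℝ) (𝕜 : Type*) [RCLike 𝕜] : Set (CoordSpace p 𝕜) :=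
  {P | ∃ a : Σ (n : ℕ) (k : ℕ), Fin k → {x : Fin n → 𝕜 // IsRationalPoint x},
    ∃ N : PNorm p 𝕜 (Fin a.1 → 𝕜), P = ⟨a.1, N⟩ ∧ ∀ x, IsGLB {r : ℝ | ∃ c : Fin a.2.1 → 𝕜,
      x = ∑ i, c i • (a.2.2 i : Fin a.1 → 𝕜) ∧ r = (∑ i, ‖c i‖ ^ p) ^ (1 / p)} (N x)}

/-- The spaces obtained from those of `S` by the pullback rule. -/
def pullbackSpaces (S : Set (CoordSpace p 𝕜)) : Set (CoordSpace p 𝕜) :=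
  {P | ∃ a : Σ (n : ℕ) (Q : S), {f : (Fin n → 𝕜) →ₗ[𝕜] (Fin Q.1.1 → 𝕜) // IsRationalMap f},
    ∃ N : PNorm p 𝕜 (Fin a.1 → 𝕜), P = ⟨a.1, N⟩ ∧ ∀ x, IsGLB {a.2.1.1.2 (a.2.2.1 x)} (N x)}

/-- The spaces obtained from those of `S` by the product rule. -/
def prodSpaces (S : Set (CoordSpace p 𝕜)) : Set (CoordSpace p 𝕜) :=
  {P | ∃ a : S × S, ∃ N : PNorm p 𝕜 (Fin (a.1.1.1 + a.2.1.1) → 𝕜), P = ⟨_, N⟩ ∧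
    ∀ z, IsGLB {max (a.1.1.2 (leftMap 𝕜 _ _ z)) (a.2.1.2 (rightMap 𝕜 _ _ z))} (N z)}

/-- The spaces obtained from those of `S` by the amalgamation rule. -/
def amalgamSpaces (S : Set (CoordSpace p 𝕜)) : Set (CoordSpace p 𝕜) :=
  {P | ∃ a : Σ (Q : S) (R : S),
      {f : (Fin Q.1.1 → 𝕜) →ₗ[𝕜] (Fin R.1.1 → 𝕜) // IsRationalMap f} × ℚ,
    ∃ N : PNorm p 𝕜 (Fin a.2.1.1.1 → 𝕜), P = ⟨_, N⟩ ∧ ∀ y, IsGLB {r : ℝ |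
      ∃ (x : Fin a.1.1.1 → 𝕜) (z : Fin a.2.1.1.1 → 𝕜), y = a.2.2.1.1 x + z ∧
        r = (a.1.1.2 x ^ p + (1 + (a.2.2.2 : ℝ)) ^ p * a.2.1.1.2 z ^ p) ^ (1 / p)} (N y)}

/-- The spaces obtained by at most `k` nested applications of the rules. -/
def allowedStage (p : ℝ) (𝕜 : Type*) [RCLike 𝕜] : ℕ → Set (CoordSpace p 𝕜)
  | 0 => rationalSpaces p 𝕜
  | k + 1 => allowedStage p 𝕜 k ∪ (pullbackSpaces (allowedStage p 𝕜 k) ∪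
      (prodSpaces (allowedStage p 𝕜 k) ∪ amalgamSpaces (allowedStage p 𝕜 k)))

/-- Each rule prescribes the values of the norm as greatest lower bounds of sets built from
countable data (singletons for pullbacks and products). So the data determine the norm, and it does
not matter whether they all define one; this is why the stages can drop injectivity and positivity
of `ε`. -/
theorem allowedStage_countable (k : ℕ) : (allowedStage p 𝕜 k).Countable := by
  induction k with
  | zero =>
    exact Set.countable_setOf_exists_of_functional _ fun _ _ _ => CoordSpace.eq_of_isGLB
  | succ k ih =>
    have := ih.to_subtype
    refine ih.union (Set.Countable.union ?_ (Set.Countable.union ?_ ?_)) <;>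
    exact Set.countable_setOf_exists_of_functional _ fun _ _ _ => CoordSpace.eq_of_isGLB

theorem allowedStage_mono : Monotone (allowedStage p 𝕜) :=
  monotone_nat_of_le_succ fun _ => Set.subset_union_left

theorem PNorm.IsAllowed.exists_mem_allowedStage {n : ℕ} {N : PNorm p 𝕜 (Fin n → 𝕜)}
    (h : N.IsAllowed) : ∃ k, (⟨n, N⟩ : CoordSpace p 𝕜) ∈ allowedStage p 𝕜 k := by
  induction h with
  | @rational n N hN =>
    obtain ⟨k, v, hv, h⟩ := hN
    exact ⟨0, ⟨n, k, fun i => ⟨v i, hv i⟩⟩, N, rfl, h⟩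
  | @pullback n m f hf hinj M hM N hN ih =>
    obtain ⟨k, hk⟩ := ih
    refine ⟨k + 1, Or.inr (Or.inl ⟨⟨n, ⟨_, hk⟩, f, hf⟩, N, rfl, fun x => ?_⟩)⟩
    rw [hN]
    exact isGLB_singleton
  | @prod n m N₁ h₁ N₂ h₂ N hN ih₁ ih₂ =>
    obtain ⟨k₁, hk₁⟩ := ih₁
    obtain ⟨k₂, hk₂⟩ := ih₂
    have h₁' := allowedStage_mono (le_max_left k₁ k₂) hk₁
    have h₂' := allowedStage_mono (le_max_right k₁ k₂) hk₂
    refine ⟨max k₁ k₂ + 1, Or.inr (Or.inr (Or.inl ⟨⟨⟨_, h₁'⟩, ⟨_, h₂'⟩⟩, N, rfl, fun z => ?_⟩))⟩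
    rw [← append_left_right z, hN, leftMap_append, rightMap_append]
    exact isGLB_singleton
  | @amalgam n m N₁ h₁ N₂ h₂ f hf ε hε N hN ih₁ ih₂ =>
    obtain ⟨k₁, hk₁⟩ := ih₁
    obtain ⟨k₂, hk₂⟩ := ih₂
    have h₁' := allowedStage_mono (le_max_left k₁ k₂) hk₁
    have h₂' := allowedStage_mono (le_max_right k₁ k₂) hk₂
    exact ⟨max k₁ k₂ + 1, Or.inr (Or.inr (Or.inr
      ⟨⟨⟨_, h₁'⟩, ⟨_, h₂'⟩, ⟨f, hf⟩, ε⟩, N, rfl, hN⟩))⟩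

instance : Countable (AllowedSpace p 𝕜) := by
  have : Countable (⋃ k, allowedStage p 𝕜 k) :=
    (Set.countable_iUnion allowedStage_countable).to_subtype
  refine Function.Injective.countable (f := fun E : AllowedSpace p 𝕜 =>
    (⟨⟨E.dim, E.norm⟩, Set.mem_iUnion.2 E.allowed.exists_mem_allowedStage⟩ :
      ⋃ k, allowedStage p 𝕜 k)) ?_
  rintro ⟨n, N, hN⟩ ⟨m, M, hM⟩ h
  have h' := congrArg Subtype.val h
  cases h'
  rfl

/-- Allowed pairs. -/
abbrev AllowedPair (E F : AllowedSpace p 𝕜) := {v : ContractivePair E.norm F.norm // v.IsAllowed}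

instance (E F : AllowedSpace p 𝕜) : Countable (AllowedPair E F) := by
  refine Function.Injective.countable (f := fun v : AllowedPair E F =>
    ((⟨v.1.emb, v.2.1⟩, ⟨v.1.proj, v.2.2⟩) :
      {f : (Fin E.dim → 𝕜) →ₗ[𝕜] (Fin F.dim → 𝕜) // IsRationalMap f} ×
        {f : (Fin F.dim → 𝕜) →ₗ[𝕜] (Fin E.dim → 𝕜) // IsRationalMap f})) ?_
  intro v w h
  have h1 := congrArg (fun t => t.1.1) h
  have h2 := congrArg (fun t => t.2.1) h
  exact Subtype.ext (ContractivePair.ext h1 h2)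

end Countable

/-! ### Amalgamation of allowed pairs -/

section Amalgam

variable {p : ℝ} {𝕜 : Type*} [RCLike 𝕜]

/-- The max-product of allowed spaces. -/
noncomputable def AllowedSpace.prod (hp : 0 < p) (E F : AllowedSpace p 𝕜) : AllowedSpace p 𝕜 where
  dim := E.dim + F.dim
  norm := E.norm.prod hp F.norm
  allowed := .prod _ E.allowed _ F.allowed _ (PNorm.prod_append hp _ _)

/-- The zero space. -/
def AllowedSpace.zero (hp : 0 < p) (𝕜 : Type*) [RCLike 𝕜] : AllowedSpace p 𝕜 where
  dim := 0
  norm := PNorm.ofDimZero p 𝕜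
  allowed := .rational _ (PNorm.ofDimZero_isRational hp)

/-- The identity as an allowed pair. -/
def AllowedPair.refl (E : AllowedSpace p 𝕜) : AllowedPair E E :=
  ⟨ContractivePair.refl _, IsRationalMap.id, IsRationalMap.id⟩

/-- The composition of allowed pairs. -/
def AllowedPair.comp {E F G : AllowedSpace p 𝕜} (v : AllowedPair F G) (u : AllowedPair E F) :
    AllowedPair E G :=
  ⟨v.1.comp u.1, v.2.1.comp u.2.1, u.2.2.comp v.2.2⟩

/-- Allowed pairs have the amalgamation property: the pullback of the projections, with the maximum
norm, is an amalgam. -/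
theorem AllowedPair.exists_amalgam (hp : 0 < p) {E F G : AllowedSpace p 𝕜} (v : AllowedPair E F)
    (b : AllowedPair E G) :
    ∃ (H : AllowedSpace p 𝕜) (w : AllowedPair F H) (u : AllowedPair G H), w.comp v = u.comp b := by
  obtain ⟨v, hv⟩ := v
  obtain ⟨b, hb⟩ := b
  let l := leftMap 𝕜 F.dim G.dim
  let r := rightMap 𝕜 F.dim G.dim
  -- `Q` projects onto the pullback `{(x, y) | v♯ x = b♯ y}`: it exchanges the component `b♭ b♯ y`
  -- of `y` for `b♭ v♯ x`. Being a rational idempotent, it identifies the pullback rationally with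
  -- some `𝕜ᵈ`.
  let Q : (Fin (F.dim + G.dim) → 𝕜) →ₗ[𝕜] (Fin (F.dim + G.dim) → 𝕜) :=
    appendMap l (r - b.emb ∘ₗ b.proj ∘ₗ r + b.emb ∘ₗ v.proj ∘ₗ l)
  have hQ : IsRationalMap Q := IsRationalMap.leftMap.appendMap ((IsRationalMap.rightMap.sub
    (hb.1.comp (hb.2.comp IsRationalMap.rightMap))).add
    (hb.1.comp (hv.2.comp IsRationalMap.leftMap)))
  have hQa : ∀ x y, Q (Fin.append x y) =
      Fin.append x (y - b.emb (b.proj y) + b.emb (v.proj x)) := by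
    intro x y
    simp [Q, l, r]
  have hQfix : ∀ x y, v.proj x = b.proj y → Q (Fin.append x y) = Fin.append x y := by
    intro x y h
    rw [hQa, h, sub_add_cancel]
  have hQproj : ∀ z, v.proj (l (Q z)) = b.proj (r (Q z)) := by
    intro z
    rw [← append_left_right z, hQa]
    simp [l, r, b.proj_emb]
  have hQQ : Q ∘ₗ Q = Q := by
    refine LinearMap.ext fun z => ?_
    rw [LinearMap.comp_apply, ← append_left_right (Q z)]
    exact hQfix _ _ (hQproj z)
  obtain ⟨d, j, s, hj, hs, hsj, hjs⟩ := hQ.exists_splitting hQQ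
  have hsj' : ∀ x, s (j x) = x := LinearMap.congr_fun hsj
  have hjs' : ∀ x, j (s x) = Q x := LinearMap.congr_fun hjs
  have hjinj : Function.Injective j := Function.LeftInverse.injective hsj'
  have hjQ : ∀ x, v.proj (l (j x)) = b.proj (r (j x)) := by
    intro x
    have := hQproj (j x)
    rwa [← hjs', hsj'] at this
  let H : AllowedSpace p 𝕜 :=
    { dim := d
      norm := (F.prod hp G).norm.comap j hjinj
      allowed := .pullback j hj hjinj _ (F.prod hp G).allowed _ fun _ => rfl }
  have hHle : ∀ x y, v.proj x = b.proj y →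
      H.norm (s (Fin.append x y)) = max (F.norm x) (G.norm y) := by
    intro x y h
    change F.norm.prod hp G.norm (j (s _)) = _
    rw [hjs', hQfix x y h, PNorm.prod_append]
  let w : ContractivePair F.norm H.norm :=
    { emb := s ∘ₗ appendMap LinearMap.id (b.emb ∘ₗ v.proj)
      proj := l ∘ₗ j
      proj_emb := fun x => by
        change l (j (s (Fin.append x (b.emb (v.proj x))))) = x
        rw [hjs', hQa, leftMap_append]
      emb_le := fun x => by
        change H.norm (s (Fin.append x (b.emb (v.proj x)))) ≤ _
        rw [hHle _ _ (b.proj_emb _).symm]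
        exact max_le le_rfl ((b.emb_le _).trans (v.proj_le _))
      proj_le := fun y => PNorm.left_le_prod hp _ _ _ }
  let u : ContractivePair G.norm H.norm :=
    { emb := s ∘ₗ appendMap (v.emb ∘ₗ b.proj) LinearMap.id
      proj := r ∘ₗ j
      proj_emb := fun x => by
        change r (j (s (Fin.append (v.emb (b.proj x)) x))) = x
        rw [hjs', hQfix _ _ (v.proj_emb _), rightMap_append]
      emb_le := fun x => by
        change H.norm (s (Fin.append (v.emb (b.proj x)) x)) ≤ _
        rw [hHle _ _ (v.proj_emb _)]
        exact max_le ((v.emb_le _).trans (b.proj_le _)) le_rfl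
      proj_le := fun y => PNorm.right_le_prod hp _ _ _ }
  refine ⟨H, ⟨w, hs.comp (IsRationalMap.id.appendMap (hb.1.comp hv.2)),
    IsRationalMap.leftMap.comp hj⟩, ⟨u, hs.comp ((hv.1.comp hb.2).appendMap IsRationalMap.id),
    IsRationalMap.rightMap.comp hj⟩, Subtype.ext (ContractivePair.ext ?_ ?_)⟩
  · refine LinearMap.ext fun x => ?_
    change s (Fin.append (v.emb x) (b.emb (v.proj (v.emb x)))) =
      s (Fin.append (v.emb (b.proj (b.emb x))) (b.emb x))
    rw [v.proj_emb, b.proj_emb]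
  · exact LinearMap.ext hjQ

end Amalgam

/-! ### Construction of a Fraïssé sequence -/

section Fraisse

variable {p : ℝ} {𝕜 : Type*} [RCLike 𝕜]

/-- A space together with pairs into it, to be thought of as the last space of a finite sequence
together with the bonding pairs into it. -/
abbrev FraisseStage (p : ℝ) (𝕜 : Type*) [RCLike 𝕜] :=
  Σ E : AllowedSpace p 𝕜, ℕ → Σ A : AllowedSpace p 𝕜, AllowedPair A E

/-- The stage that follows the stage `t` of index `s` along the pair `u`. -/
def FraisseStage.next (s : ℕ) (t : FraisseStage p 𝕜) (H : AllowedSpace p 𝕜) (u : AllowedPair t.1 H) :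
    FraisseStage p 𝕜 :=
  ⟨H, fun n => if n ≤ s then ⟨(t.2 n).1, u.comp (t.2 n).2⟩ else ⟨H, AllowedPair.refl H⟩⟩

/-- At step `s`, which codes `(n, j)`, the `j`-th allowed pair out of `Uₙ` is amalgamated with the
bonding pair `Uₙ ⇄ Uₛ`, and the amalgam is `Uₛ₊₁`. The code satisfies `n ≤ s`, so that bonding pair
is available, and every pair out of every `Uₙ` is treated. -/
theorem exists_isFraisse (hp : 0 < p) (𝕜 : Type*) [RCLike 𝕜] :
    ∃ U : AllowedSequence p 𝕜, U.IsFraisse := by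
  have hg : ∀ A : AllowedSpace p 𝕜, ∃ g : ℕ → Σ F : AllowedSpace p 𝕜, AllowedPair A F,
      Function.Surjective g := by
    intro A
    have : Nonempty (Σ F : AllowedSpace p 𝕜, AllowedPair A F) := ⟨⟨A, AllowedPair.refl A⟩⟩
    exact exists_surjective_nat _
  choose g hg using hg
  -- Stating the property through equations between dependent pairs lets the recorded history be
  -- identified later with the bonding pairs without casts.
  have hnext : ∀ (s : ℕ) (t : FraisseStage p 𝕜), ∃ (H : AllowedSpace p 𝕜) (u : AllowedPair t.1 H),
      ∀ A b, t.2 s.unpair.1 = ⟨A, b⟩ → ∀ F v, g A s.unpair.2 = ⟨F, v⟩ →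
        ∃ w : AllowedPair F H, w.comp v = u.comp b := by
    intro s t
    obtain ⟨H, w, u, h⟩ := AllowedPair.exists_amalgam hp
      (g (t.2 s.unpair.1).1 s.unpair.2).2 (t.2 s.unpair.1).2
    refine ⟨H, u, ?_⟩
    generalize t.2 s.unpair.1 = a at w h
    intro A b hab
    subst hab
    dsimp only at w h ⊢
    generalize g A s.unpair.2 = c at w h
    intro F v hcv
    subst hcv
    exact ⟨w, h⟩
  choose H u hu using hnext
  -- In stage `s`, entry `n ≤ s` of the history is the bonding pair from `Uₙ`, the identity for `n =
  -- s`; entries beyond `s` are placeholders, since the code only refers to `n ≤ s`.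
  let t : ℕ → FraisseStage p 𝕜 := fun s => Nat.rec
    ⟨AllowedSpace.zero hp 𝕜, fun _ => ⟨_, AllowedPair.refl _⟩⟩
    (fun s t => t.next s (H s t) (u s t)) s
  let U : AllowedSequence p 𝕜 :=
    { space := fun s => (t s).1
      pair := fun s => (u s (t s)).1
      pair_allowed := fun s => (u s (t s)).2 }
  have hbond_allowed : ∀ n k, (U.bond n k).IsAllowed := by
    intro n k
    induction k with
    | zero => exact (AllowedPair.refl _).2
    | succ k ih => exact (AllowedPair.comp ⟨_, U.pair_allowed (n + k)⟩ ⟨_, ih⟩).2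
  have hhist : ∀ n k, (t (n + k)).2 n = ⟨U.space n, ⟨U.bond n k, hbond_allowed n k⟩⟩ := by
    intro n k
    induction k with
    | zero =>
      cases n with
      | zero => rfl
      | succ s => exact if_neg (by omega)
    | succ k ih =>
      have h1 : (t (n + (k + 1))).2 n =
          ⟨((t (n + k)).2 n).1, (u (n + k) (t (n + k))).comp ((t (n + k)).2 n).2⟩ :=
        if_pos (Nat.le_add_right n k)
      rw [h1, ih]
      rfl
  refine ⟨U, fun n F v hv => ?_⟩
  obtain ⟨j, hj⟩ := hg (U.space n) ⟨F, ⟨v, hv⟩⟩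
  obtain ⟨k, hk⟩ := Nat.exists_eq_add_of_le (Nat.left_le_pair n j)
  have hun : (n + k).unpair = (n, j) := by rw [← hk, Nat.unpair_pair]
  obtain ⟨w, hw⟩ := hu (n + k) (t (n + k)) (U.space n) ⟨U.bond n k, hbond_allowed n k⟩
    (by rw [hun]; exact hhist n k) F ⟨v, hv⟩ (by rw [hun]; exact hj)
  exact ⟨k + 1, by omega, w.1, w.2, congrArg Subtype.val hw⟩

end Fraisse

/-! ### Uniform closure of a space of bounded sequences -/

namespace PNorm

variable {p : ℝ} {𝕜 : Type*} [RCLike 𝕜]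

section SupClosure

variable {V : ℕ → Type*} [∀ m, AddCommGroup (V m)] [∀ m, Module 𝕜 (V m)]
  (N : ∀ m, PNorm p 𝕜 (V m)) (A : Submodule 𝕜 (∀ m, V m))

/-- The closure of a space of sequences in the topology of uniform convergence. -/
def supClosure (hp : 0 < p) : Submodule 𝕜 (∀ m, V m) where
  carrier := {x | ∀ ε > 0, ∃ a ∈ A, ∀ m, (N m).q (x m - a m) ≤ ε}
  zero_mem' ε hε := ⟨0, A.zero_mem, fun m => by
    rw [sub_self, q_zero hp]
    exact hε.le⟩
  add_mem' := by
    intro x y hx hy ε hε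
    obtain ⟨a, ha, h1⟩ := hx (ε / 2) (half_pos hε)
    obtain ⟨b, hb, h2⟩ := hy (ε / 2) (half_pos hε)
    refine ⟨a + b, A.add_mem ha hb, fun m => ?_⟩
    have h3 := (N m).q_add_le (x m - a m) (y m - b m)
    rw [sub_add_sub_comm] at h3
    exact h3.trans (by linarith [h1 m, h2 m])
  smul_mem' := by
    intro c x hx ε hε
    have hc : 0 < ‖c‖ ^ p + 1 := by positivity
    obtain ⟨a, ha, h1⟩ := hx (ε / (‖c‖ ^ p + 1)) (by positivity)
    refine ⟨c • a, A.smul_mem c ha, fun m => ?_⟩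
    have h2 := h1 m
    rw [le_div_iff₀ hc] at h2
    rw [Pi.smul_apply, Pi.smul_apply, ← smul_sub, q_smul]
    nlinarith [(N m).q_nonneg (x m - a m)]

theorem le_supClosure (hp : 0 < p) : A ≤ supClosure N A hp := fun x hx ε hε =>
  ⟨x, hx, fun m => by
    rw [sub_self, q_zero hp]
    exact hε.le⟩

variable {N A} in
theorem bddAbove_of_mem_supClosure (hp : 0 < p)
    (hA : ∀ a ∈ A, BddAbove (Set.range fun m => N m (a m))) {x : ∀ m, V m}
    (hx : x ∈ supClosure N A hp) : BddAbove (Set.range fun m => N m (x m)) := by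
  obtain ⟨a, ha, h⟩ := hx 1 one_pos
  obtain ⟨C, hC⟩ := hA a ha
  have hC' : ∀ m, N m (a m) ≤ C := fun m => hC ⟨m, rfl⟩
  have hC0 : 0 ≤ C := ((N 0).nonneg' _).trans (hC' 0)
  refine ⟨(C ^ p + 1) ^ (1 / p), ?_⟩
  rintro _ ⟨m, rfl⟩
  have h1 := (N m).q_le_add_sub (x m) (a m)
  have h2 : (N m).q (a m) ≤ C ^ p := Real.rpow_le_rpow ((N m).nonneg' _) (hC' m) hp.le
  have h3 : (N m).q (x m) ≤ C ^ p + 1 := by linarith [h m]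
  have h4 := Real.rpow_le_rpow ((N m).q_nonneg _) h3 (show 0 ≤ 1 / p by positivity)
  rwa [q, ← Real.rpow_mul ((N m).nonneg' _), mul_one_div_cancel hp.ne', Real.rpow_one] at h4

variable {N A} in
/-- The supremum `p`-norm on the uniform closure of a space of bounded sequences. -/
noncomputable def supNorm (hp : 0 < p)
    (hA : ∀ a ∈ A, BddAbove (Set.range fun m => N m (a m))) : PNorm p 𝕜 (supClosure N A hp) where
  toFun x := ⨆ m, N m (x.1 m)
  nonneg' x := Real.iSup_nonneg fun m => (N m).nonneg' _
  eq_zero_iff' x := by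
    constructor
    · intro h
      apply Subtype.ext
      funext m
      have h1 := le_ciSup (bddAbove_of_mem_supClosure hp hA x.2) m
      rw [h] at h1
      exact ((N m).eq_zero_iff' _).1 (le_antisymm h1 ((N m).nonneg' _))
    · rintro rfl
      simp [PNorm.map_zero]
  smul' c x := by
    rw [Real.mul_iSup_of_nonneg (norm_nonneg c)]
    exact iSup_congr fun m => (N m).smul' c _
  add_rpow_le' x y := by
    have hx0 : 0 ≤ ⨆ m, N m (x.1 m) := Real.iSup_nonneg fun m => (N m).nonneg' _
    have hy0 : 0 ≤ ⨆ m, N m (y.1 m) := Real.iSup_nonneg fun m => (N m).nonneg' _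
    have h0 : 0 ≤ ⨆ m, N m ((x + y).1 m) := Real.iSup_nonneg fun m => (N m).nonneg' _
    rw [← Real.le_rpow_inv_iff_of_pos h0 (by positivity) hp]
    refine ciSup_le fun m => ?_
    rw [Real.le_rpow_inv_iff_of_pos ((N m).nonneg' _) (by positivity) hp]
    refine ((N m).add_rpow_le' _ _).trans (add_le_add ?_ ?_)
    · exact Real.rpow_le_rpow ((N m).nonneg' _)
        (le_ciSup (bddAbove_of_mem_supClosure hp hA x.2) m) hp.le
    · exact Real.rpow_le_rpow ((N m).nonneg' _)
        (le_ciSup (bddAbove_of_mem_supClosure hp hA y.2) m) hp.le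

variable {N A}

theorem supNorm_le_iff (hp : 0 < p) (hA : ∀ a ∈ A, BddAbove (Set.range fun m => N m (a m)))
    {x : supClosure N A hp} {c : ℝ} : supNorm hp hA x ≤ c ↔ ∀ m, N m (x.1 m) ≤ c :=
  ⟨fun h m => (le_ciSup (bddAbove_of_mem_supClosure hp hA x.2) m).trans h, fun h => ciSup_le h⟩

/-- Coordinatewise limits exist; letting the second index grow in the Cauchy estimate makes the
convergence uniform, so the limit stays in the uniform closure. -/
theorem supNorm_isComplete (hp : 0 < p) (hN : ∀ m, (N m).IsComplete)
    (hA : ∀ a ∈ A, BddAbove (Set.range fun m => N m (a m))) : (supNorm hp hA).IsComplete := by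
  intro s hs
  have hcoord : ∀ m, ∃ x : V m, ∀ ε : ℝ, 0 < ε → ∃ n, ∀ k ≥ n, N m ((s k).1 m - x) < ε := by
    intro m
    refine hN m _ fun ε hε => ?_
    obtain ⟨n, hn⟩ := hs ε hε
    exact ⟨n, fun k hk l hl => ((supNorm_le_iff hp hA).1 le_rfl m).trans_lt (hn k hk l hl)⟩
  choose x hx using hcoord
  have hunif : ∀ ε : ℝ, 0 < ε → ∃ n, ∀ k ≥ n, ∀ m, (N m).q ((s k).1 m - x m) ≤ ε := by
    intro ε hε
    obtain ⟨n, hn⟩ := hs (ε ^ (1 / p)) (by positivity)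
    refine ⟨n, fun k hk m => le_of_forall_pos_lt_add fun δ hδ => ?_⟩
    obtain ⟨n', hn'⟩ := hx m (δ ^ (1 / p)) (by positivity)
    have h1 := (q_lt_iff hp hδ).2 (hn' (max n n') (le_max_right _ _))
    have h2 := (q_lt_iff hp hε).2 (((supNorm_le_iff hp hA).1 le_rfl m).trans_lt
      (hn k hk (max n n') (le_max_left _ _)))
    have h3 := (N m).q_sub_le ((s k).1 m) ((s (max n n')).1 m) (x m)
    have h4 : (N m).q ((s k).1 m - (s (max n n')).1 m) < ε := h2
    linarith
  have hxmem : x ∈ supClosure N A hp := by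
    intro ε hε
    obtain ⟨n, hn⟩ := hunif (ε / 2) (half_pos hε)
    obtain ⟨a, ha, h⟩ := (s n).2 (ε / 2) (half_pos hε)
    refine ⟨a, ha, fun m => ?_⟩
    have h1 := (N m).q_sub_le (x m) ((s n).1 m) (a m)
    have h2 := hn n le_rfl m
    rw [(N m).q_sub_comm] at h2
    linarith [h m]
  refine ⟨⟨x, hxmem⟩, fun ε hε => ?_⟩
  obtain ⟨n, hn⟩ := hunif ((ε / 2) ^ p) (by positivity)
  refine ⟨n, fun k hk => lt_of_le_of_lt ((supNorm_le_iff hp hA).2 fun m => ?_) (half_lt_self hε)⟩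
  exact (Real.rpow_le_rpow_iff ((N m).nonneg' _) (by positivity) hp).1 (hn k hk m)

end SupClosure

end PNorm

theorem ContractivePair.norm_emb {p : ℝ} {𝕜 : Type*} [RCLike 𝕜]
    {E : Type*} [AddCommGroup E] [Module 𝕜 E] {F : Type*} [AddCommGroup F] [Module 𝕜 F]
    {N : PNorm p 𝕜 E} {M : PNorm p 𝕜 F} (u : ContractivePair N M) (x : E) :
    M (u.emb x) = N x :=
  le_antisymm (u.emb_le x) (by simpa only [u.proj_emb] using u.proj_le (u.emb x))

/-! ### The direct limit as a space of threads -/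

namespace AllowedSequence

variable {p : ℝ} {𝕜 : Type*} [RCLike 𝕜] (U : AllowedSequence p 𝕜)

/-- The underlying vector spaces of a sequence. -/
abbrev Carrier (n : ℕ) := Fin (U.space n).dim → 𝕜

/-- The bonding embedding `Uₙ → Uₘ`, `n ≤ m`. -/
def up {n m : ℕ} (h : n ≤ m) : U.Carrier n →ₗ[𝕜] U.Carrier m :=
  Nat.leRecOn (C := fun k => U.Carrier n →ₗ[𝕜] U.Carrier k) h
    (fun {k} g => (U.pair k).emb ∘ₗ g) LinearMap.id

/-- The bonding projection `Uₙ → Uₘ`, `m ≤ n`. -/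
def down {m n : ℕ} (h : m ≤ n) : U.Carrier n →ₗ[𝕜] U.Carrier m :=
  Nat.leRecOn (C := fun k => U.Carrier k →ₗ[𝕜] U.Carrier m) h
    (fun {k} g => g ∘ₗ (U.pair k).proj) LinearMap.id

theorem up_self (n : ℕ) : U.up (le_refl n) = LinearMap.id := Nat.leRecOn_self _

theorem down_self (n : ℕ) : U.down (le_refl n) = LinearMap.id := Nat.leRecOn_self _

theorem up_succ {n m : ℕ} (h : n ≤ m) :
    U.up (h.trans (Nat.le_succ m)) = (U.pair m).emb ∘ₗ U.up h :=
  Nat.leRecOn_succ h _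

theorem down_succ {m n : ℕ} (h : m ≤ n) :
    U.down (h.trans (Nat.le_succ n)) = U.down h ∘ₗ (U.pair n).proj :=
  Nat.leRecOn_succ h _

theorem up_emb {n m : ℕ} (h : n + 1 ≤ m) :
    U.up h ∘ₗ (U.pair n).emb = U.up ((Nat.le_succ n).trans h) := by
  induction m, h using Nat.le_induction with
  | base => rw [up_self, U.up_succ le_rfl, up_self]; rfl
  | succ m h ih =>
    rw [U.up_succ h, LinearMap.comp_assoc, ih, ← U.up_succ]

theorem norm_up_le {n m : ℕ} (h : n ≤ m) (x : U.Carrier n) :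
    (U.space m).norm (U.up h x) ≤ (U.space n).norm x := by
  induction m, h using Nat.le_induction with
  | base => rw [up_self]; rfl
  | succ m h ih => rw [U.up_succ h]; exact ((U.pair m).emb_le _).trans ih

theorem norm_down_le {m n : ℕ} (h : m ≤ n) (x : U.Carrier n) :
    (U.space m).norm (U.down h x) ≤ (U.space n).norm x := by
  induction n, h using Nat.le_induction with
  | base => rw [down_self]; rfl
  | succ n h ih => rw [U.down_succ h]; exact (ih _).trans ((U.pair n).proj_le _)

/-- The embedding of `Uₙ` into the space of sequences. -/
def thread (n : ℕ) : U.Carrier n →ₗ[𝕜] ∀ m, U.Carrier m :=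
  LinearMap.pi fun m => if h : n ≤ m then U.up h else U.down (le_of_not_ge h)

theorem thread_self (n : ℕ) (x : U.Carrier n) : U.thread n x n = x := by
  simp [thread, up_self]

theorem norm_thread_le (n : ℕ) (x : U.Carrier n) (m : ℕ) :
    (U.space m).norm (U.thread n x m) ≤ (U.space n).norm x := by
  by_cases h : n ≤ m
  · simpa [thread, h] using U.norm_up_le h x
  · simpa [thread, h] using U.norm_down_le (le_of_not_ge h) x

/-- Above `n` this is functoriality of the embeddings; at `n` and below, the projection of the pair
undoes its embedding. It makes the ranges of the threads an increasing chain. -/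
theorem thread_emb (n : ℕ) (x : U.Carrier n) :
    U.thread (n + 1) ((U.pair n).emb x) = U.thread n x := by
  funext m
  by_cases h : n + 1 ≤ m
  · have h' : n ≤ m := (Nat.le_succ n).trans h
    simp only [thread, LinearMap.pi_apply, dif_pos h, dif_pos h']
    exact LinearMap.congr_fun (U.up_emb h) x
  · have h' : m ≤ n := by omega
    have hd : U.thread (n + 1) ((U.pair n).emb x) m = U.down h' x := by
      simp only [thread, LinearMap.pi_apply, dif_neg h]
      rw [U.down_succ h', LinearMap.comp_apply, (U.pair n).proj_emb]
    rw [hd]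
    rcases h'.eq_or_lt with rfl | hlt
    · rw [thread_self, down_self]; rfl
    · simp only [thread, LinearMap.pi_apply, dif_neg (not_le_of_gt hlt)]

/-- The union of the spaces `Uₙ`. -/
def union : Submodule 𝕜 (∀ m, U.Carrier m) := ⨆ n, LinearMap.range (U.thread n)

theorem mem_union {x : ∀ m, U.Carrier m} : x ∈ U.union ↔ ∃ n z, U.thread n z = x := by
  have hmono : Monotone fun n => LinearMap.range (U.thread n) := by
    refine monotone_nat_of_le_succ fun n => ?_
    rintro _ ⟨z, rfl⟩
    exact ⟨(U.pair n).emb z, U.thread_emb n z⟩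
  exact Submodule.mem_iSup_of_chain ⟨_, hmono⟩ x

theorem bddAbove_of_mem_union {x : ∀ m, U.Carrier m} (hx : x ∈ U.union) :
    BddAbove (Set.range fun m => (U.space m).norm (x m)) := by
  obtain ⟨n, z, rfl⟩ := U.mem_union.1 hx
  refine ⟨(U.space n).norm z, ?_⟩
  rintro _ ⟨m, rfl⟩
  exact U.norm_thread_le n z m

/-- Bonding maps are contractive and coordinate `n` of a thread from `Uₙ` is the vector itself, so
the supremum is attained there and threads are isometric. Density is built into the uniform closure.
-/
theorem isDirectLimit_supNorm (hp : 0 < p) :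
    U.IsDirectLimit (PNorm.supNorm hp fun _ => U.bddAbove_of_mem_union) := by
  refine ⟨PNorm.supNorm_isComplete hp (fun m => (U.space m).norm.isComplete_of_fin hp) _,
    fun n => (U.thread n).codRestrict _ fun z => PNorm.le_supClosure _ _ hp
      (U.mem_union.2 ⟨n, z, rfl⟩), fun n x => ?_, fun n x => Subtype.ext (U.thread_emb n x),
    fun y ε hε => ?_⟩
  · refine le_antisymm ((PNorm.supNorm_le_iff hp _).2 fun m => U.norm_thread_le n x m) ?_
    refine le_trans (le_of_eq ?_) ((PNorm.supNorm_le_iff hp _).1 le_rfl n)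
    exact congrArg _ (U.thread_self n x).symm
  · obtain ⟨a, ha, h⟩ := y.2 ((ε / 2) ^ p) (by positivity)
    obtain ⟨n, z, rfl⟩ := U.mem_union.1 ha
    refine ⟨n, z, lt_of_le_of_lt ((PNorm.supNorm_le_iff hp _).2 fun m => ?_) (half_lt_self hε)⟩
    exact (Real.rpow_le_rpow_iff (PNorm.nonneg' _ _) (by positivity) hp).1 (h m)

end AllowedSequence

/-! ### Approximation by rational `p`-norms and rational contractions -/

namespace PNorm

variable {p : ℝ} {𝕜 : Type*} [RCLike 𝕜]

/-- This passes to an infimum under a `p`-th power. Nonpositive `t` is separated because `t` must be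
brought to the power `p⁻¹`. -/
theorem le_rpow_of_isGLB (hp : 0 < p) {S : Set ℝ} {a t : ℝ} (hS : IsGLB S a) (hS0 : ∀ r ∈ S, 0 ≤ r)
    (h : ∀ r ∈ S, t ≤ r ^ p) : t ≤ a ^ p := by
  have ha : 0 ≤ a := hS.2 hS0
  rcases le_or_gt t 0 with ht | ht
  · exact ht.trans (by positivity)
  · have h1 : t ^ p⁻¹ ≤ a := hS.2 fun r hr => by
      rw [Real.rpow_inv_le_iff_of_pos ht.le (hS0 r hr) hp]
      exact h r hr
    rwa [Real.rpow_inv_le_iff_of_pos ht.le ha hp] at h1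

/-- Finitely many rational points of the unit ball of `N` that span the space are the atoms of a
rational `p`-norm. -/
theorem exists_isRational_of_atoms (hp : 0 < p) (hp1 : p ≤ 1) {n k : ℕ}
    (N : PNorm p 𝕜 (Fin n → 𝕜)) (v : Fin k → Fin n → 𝕜) (hv : ∀ i, IsRationalPoint (v i))
    (hN : ∀ i, N.q (v i) ≤ 1) (hspan : ∀ x, ∃ c : Fin k → 𝕜, x = ∑ i, c i • v i) :
    ∃ R : PNorm p 𝕜 (Fin n → 𝕜), R.IsRational ∧ (∀ x, N.q x ≤ R.q x) ∧ ∀ i, R.q (v i) ≤ 1 := by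
  let S : (Fin n → 𝕜) → Set ℝ := fun x =>
    {r | ∃ c : Fin k → 𝕜, x = ∑ i, c i • v i ∧ r = (∑ i, ‖c i‖ ^ p) ^ (1 / p)}
  have hsum0 : ∀ c : Fin k → 𝕜, 0 ≤ ∑ i, ‖c i‖ ^ p := fun c =>
    Finset.sum_nonneg fun i _ => by positivity
  have hpow : ∀ c : Fin k → 𝕜, ((∑ i, ‖c i‖ ^ p) ^ (1 / p)) ^ p = ∑ i, ‖c i‖ ^ p := by
    intro c
    rw [← Real.rpow_mul (hsum0 c), one_div_mul_cancel hp.ne', Real.rpow_one]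
  have hS0 : ∀ x, ∀ r ∈ S x, 0 ≤ r := by
    rintro x r ⟨c, -, rfl⟩
    exact Real.rpow_nonneg (hsum0 c) _
  have hSN : ∀ x, ∀ r ∈ S x, N x ≤ r := by
    rintro x r ⟨c, rfl, rfl⟩
    rw [← Real.rpow_le_rpow_iff (N.nonneg' _) (Real.rpow_nonneg (hsum0 c) _) hp, hpow]
    refine (N.q_sum_le hp _ _).trans (Finset.sum_le_sum fun i _ => ?_)
    rw [q_smul]
    exact mul_le_of_le_one_right (by positivity) (hN i)
  -- Spanning makes the sets nonempty, and `N` bounds them below; the latter also gives definiteness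
  -- of the infimum.
  have hglb : ∀ x, IsGLB (S x) (sInf (S x)) := fun x =>
    Real.isGLB_sInf (by obtain ⟨c, hc⟩ := hspan x; exact ⟨_, c, hc, rfl⟩) ⟨N x, hSN x⟩
  have hle : ∀ x, N x ≤ sInf (S x) := fun x => (hglb x).2 (hSN x)
  have hzero : sInf (S 0) = 0 := by
    refine le_antisymm ((hglb 0).1 ⟨0, by simp, ?_⟩) ((N.nonneg' 0).trans (hle 0))
    simp [Real.zero_rpow hp.ne', Real.zero_rpow (inv_ne_zero hp.ne')]
  have hsmul : ∀ (c : 𝕜) x, sInf (S (c • x)) ≤ ‖c‖ * sInf (S x) := by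
    intro c x
    by_cases hc : c = 0
    · simp [hc, hzero]
    · have hc' : 0 < ‖c‖ := norm_pos_iff.2 hc
      rw [← div_le_iff₀' hc']
      refine (hglb x).2 ?_
      rintro r ⟨d, rfl, rfl⟩
      rw [div_le_iff₀' hc']
      refine (hglb _).1 ⟨fun i => c * d i, by simp [Finset.smul_sum, mul_smul], ?_⟩
      simp only [norm_mul, Real.mul_rpow (norm_nonneg _) (norm_nonneg _)]
      rw [← Finset.mul_sum, Real.mul_rpow (by positivity) (hsum0 d),
        ← Real.rpow_mul (norm_nonneg c), mul_one_div_cancel hp.ne', Real.rpow_one]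
  let R : PNorm p 𝕜 (Fin n → 𝕜) :=
    { toFun := fun x => sInf (S x)
      nonneg' := fun x => (N.nonneg' x).trans (hle x)
      eq_zero_iff' := fun x => ⟨fun h => (N.eq_zero_iff' x).1
        (le_antisymm ((hle x).trans h.le) (N.nonneg' x)), by rintro rfl; exact hzero⟩
      smul' := fun c x => by
        refine le_antisymm (hsmul c x) ?_
        by_cases hc : c = 0
        · simp [hc, hzero]
        · have h := hsmul c⁻¹ (c • x)
          rwa [inv_smul_smul₀ hc, norm_inv, inv_mul_eq_div,
            le_div_iff₀' (norm_pos_iff.2 hc)] at h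
      -- The two infima on the right are taken one at a time. Here `p ≤ 1` enters, through
      -- subadditivity of `t ↦ t ^ p`.
      add_rpow_le' := fun x y => by
        rw [← sub_le_iff_le_add]
        refine le_rpow_of_isGLB hp (hglb x) (hS0 x) ?_
        rintro r ⟨c, hc, rfl⟩
        rw [sub_le_iff_le_add, ← sub_le_iff_le_add']
        refine le_rpow_of_isGLB hp (hglb y) (hS0 y) ?_
        rintro r ⟨d, hd, rfl⟩
        rw [sub_le_iff_le_add', hpow, hpow, ← Finset.sum_add_distrib]
        have hmem : (∑ i, ‖c i + d i‖ ^ p) ^ (1 / p) ∈ S (x + y) :=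
          ⟨fun i => c i + d i, by simp [hc, hd, add_smul, Finset.sum_add_distrib], rfl⟩
        refine (Real.rpow_le_rpow ((N.nonneg' _).trans (hle _)) ((hglb _).1 hmem) hp.le).trans ?_
        rw [hpow fun i => c i + d i]
        refine Finset.sum_le_sum fun i _ => ?_
        exact (Real.rpow_le_rpow (norm_nonneg _) (norm_add_le _ _) hp.le).trans
          (Real.rpow_add_le_add_rpow (norm_nonneg _) (norm_nonneg _) hp.le hp1) }
  refine ⟨R, ⟨k, v, hv, hglb⟩, fun x => (q_le_q hp).2 (hle x), fun i => ?_⟩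
  have h1 : R (v i) ≤ 1 := (hglb (v i)).1 ⟨Pi.single i 1, by simp [Pi.single_apply], by
    simp [Pi.single_apply, apply_ite, Real.zero_rpow hp.ne']⟩
  exact Real.rpow_le_one (R.nonneg' _) h1 hp.le

theorem isCompact_setOf_q_le (hp : 0 < p) {n : ℕ} (N : PNorm p 𝕜 (Fin n → 𝕜)) (r : ℝ) :
    IsCompact {x | N.q x ≤ r} := by
  obtain ⟨D, hD, hDle⟩ := N.exists_norm_rpow_le_q hp
  refine Metric.isCompact_of_isClosed_isBounded
    (isClosed_le (N.continuous_q hp) continuous_const) ?_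
  rw [isBounded_iff_forall_norm_le]
  refine ⟨(D * |r|) ^ p⁻¹, fun x hx => ?_⟩
  have hx' : N.q x ≤ r := hx
  rw [Real.le_rpow_inv_iff_of_pos (norm_nonneg _) (by positivity) hp]
  exact (hDle x).trans (mul_le_mul_of_nonneg_left (hx'.trans (le_abs_self r)) hD.le)

/-- Rational `p`-norms approximate all `p`-norms on coordinate spaces. -/
theorem exists_isRational_near (hp : 0 < p) (hp1 : p ≤ 1) {n : ℕ} (N : PNorm p 𝕜 (Fin n → 𝕜))
    {ε : ℝ} (hε : 0 < ε) :
    ∃ R : PNorm p 𝕜 (Fin n → 𝕜), R.IsRational ∧ ∀ x, N.q x ≤ R.q x ∧ R.q x ≤ (1 + ε) * N.q x := by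
  classical
  obtain ⟨C, hC, hCle⟩ := N.exists_q_le_norm_rpow hp
  -- The vectors `t eᵢ` lie in the unit ball of `N`. As atoms they span the space and give the a
  -- priori bound `R.q x ≤ D ‖x‖ ^ p`.
  obtain ⟨t, ht0, ht⟩ : ∃ t : ℚ, 0 < t ∧ C * (t : ℝ) ^ p ≤ 1 := by
    obtain ⟨t, ht0, ht1⟩ := exists_rat_btwn (show (0 : ℝ) < (1 / C) ^ p⁻¹ by positivity)
    have ht0' : (0 : ℝ) < t := ht0
    refine ⟨t, by exact_mod_cast ht0, ?_⟩
    have := ht1.le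
    rw [Real.le_rpow_inv_iff_of_pos ht0'.le (by positivity) hp, le_div_iff₀ hC] at this
    linarith
  have ht0' : (0 : ℝ) < t := by exact_mod_cast ht0
  have ht𝕜 : (t : 𝕜) ≠ 0 := by exact_mod_cast ht0.ne'
  have htnorm : ‖(t : 𝕜)‖ = t := by
    have : (t : 𝕜) = ((t : ℝ) : 𝕜) := by simp
    rw [this, RCLike.norm_ofReal, abs_of_pos ht0']
  let D : ℝ := n * (1 / (t : ℝ)) ^ p
  have hD : 0 ≤ D := by positivity
  -- `κ` solves `(1 + ε)(1 - κ) = 1 + κ`: it suffices to send the `N.q`-ball of radius `1 - κ` into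
  -- the `R.q`-ball of radius `1 + κ`.
  let κ : ℝ := (ε / 2) / (1 + ε / 2)
  have hκ : 0 < κ := by positivity
  have hκ1 : (1 + ε / 2)⁻¹ = 1 - κ := by
    simp only [κ]
    field_simp
    ring
  -- The other atoms are rational points within `δ` of a `δ`-net of the ball of radius `1 - κ`. As
  -- `C δ ^ p ≤ κ`, they stay in the unit ball of `N`; as `D (2 δ) ^ p ≤ κ`, a point of the smaller
  -- ball, being within `2 δ` of an atom, has `R.q` at most `1 + κ`.
  let δ : ℝ := (κ / (C + D * 2 ^ p)) ^ p⁻¹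
  have hδ : 0 < δ := by positivity
  have hδp : δ ^ p * (C + D * 2 ^ p) = κ := by
    simp only [δ]
    rw [← Real.rpow_mul (by positivity), inv_mul_cancel₀ hp.ne', Real.rpow_one,
      div_mul_cancel₀ _ (by positivity)]
  have hδ2 : 0 ≤ D * 2 ^ p * δ ^ p := by positivity
  have hδ3 : 0 ≤ C * δ ^ p := by positivity
  obtain ⟨F, hFK, hF, hcover⟩ := (N.isCompact_setOf_q_le hp (1 - κ)).finite_cover_balls hδ
  choose w hw hwδ using fun x : Fin n → 𝕜 => exists_isRationalPoint_norm_sub_lt x hδ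
  let e := hF.toFinset.equivFin
  let v₁ : Fin n → Fin n → 𝕜 := fun i => Pi.single i (t : 𝕜)
  let v₂ : Fin hF.toFinset.card → Fin n → 𝕜 := fun i => w (e.symm i)
  have hrep : ∀ x : Fin n → 𝕜, x = ∑ i, (x i / t) • v₁ i := by
    intro x
    ext j
    simp [v₁, Finset.sum_apply, Pi.single_apply, div_mul_cancel₀ _ ht𝕜]
  obtain ⟨R, hR, hNR, hRv⟩ := exists_isRational_of_atoms hp hp1 N (Fin.append v₁ v₂)
    (by
      intro i
      induction i using Fin.addCases with
      | left i =>
        rw [Fin.append_left]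
        exact IsRationalPoint.single (mem_rationalSubfield_iff.2 ⟨t, 0, by simp⟩)
      | right i =>
        rw [Fin.append_right]
        exact hw _)
    (by
      intro i
      induction i using Fin.addCases with
      | left i =>
        rw [Fin.append_left]
        refine (hCle _).trans ?_
        simpa [v₁, Pi.norm_single, htnorm] using ht
      | right i =>
        rw [Fin.append_right]
        have h1 : N.q (e.symm i : Fin n → 𝕜) ≤ 1 - κ := hFK (hF.mem_toFinset.1 (e.symm i).2)
        have h2 := N.q_le_add_sub (v₂ i) (e.symm i)
        rw [N.q_sub_comm] at h2
        have h3 := hCle ((e.symm i : Fin n → 𝕜) - v₂ i)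
        have h4 : C * ‖(e.symm i : Fin n → 𝕜) - v₂ i‖ ^ p ≤ C * δ ^ p :=
          mul_le_mul_of_nonneg_left
            (Real.rpow_le_rpow (norm_nonneg _) (hwδ _).le hp.le) hC.le
        linarith)
    (by
      intro x
      refine ⟨Fin.append (fun i => x i / t) 0, ?_⟩
      rw [Fin.sum_univ_add]
      simpa using hrep x)
  have hR₁ : ∀ i, R.q (v₁ i) ≤ 1 := fun i => by simpa using hRv (Fin.castAdd _ i)
  have hR₂ : ∀ i, R.q (v₂ i) ≤ 1 := fun i => by simpa using hRv (Fin.natAdd _ i)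
  have hRD : ∀ x, R.q x ≤ D * ‖x‖ ^ p := by
    intro x
    conv_lhs => rw [hrep x]
    refine (R.q_sum_le hp _ _).trans ?_
    calc _ ≤ ∑ _i : Fin n, (1 / (t : ℝ)) ^ p * ‖x‖ ^ p := by
          refine Finset.sum_le_sum fun i _ => ?_
          rw [q_smul, norm_div, htnorm, ← Real.mul_rpow (by positivity) (norm_nonneg x)]
          refine (mul_le_of_le_one_right (by positivity) (hR₁ i)).trans ?_
          refine Real.rpow_le_rpow (by positivity) ?_ hp.le
          rw [one_div_mul_eq_div]
          exact div_le_div_of_nonneg_right (norm_le_pi_norm x i) ht0'.le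
      _ = D * ‖x‖ ^ p := by simp [D, mul_assoc]
  have hball : ∀ y, N.q y ≤ 1 - κ → R.q y ≤ 1 + κ := by
    intro y hy
    obtain ⟨x, hxF, hxy⟩ := Set.mem_iUnion₂.1 (hcover hy)
    rw [Metric.mem_ball, dist_eq_norm] at hxy
    have hv := hR₂ (e ⟨x, hF.mem_toFinset.2 hxF⟩)
    simp only [v₂, Equiv.symm_apply_apply] at hv
    have h1 := R.q_le_add_sub y (w x)
    have h2 : ‖y - w x‖ ≤ 2 * δ := by
      have := norm_sub_le_norm_sub_add_norm_sub y x (w x)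
      linarith [hwδ x]
    have h3 : D * ‖y - w x‖ ^ p ≤ D * (2 * δ) ^ p :=
      mul_le_mul_of_nonneg_left (Real.rpow_le_rpow (norm_nonneg _) h2 hp.le) hD
    rw [Real.mul_rpow (by norm_num) hδ.le] at h3
    linarith [hRD (y - w x)]
  refine ⟨R, hR, fun x => ⟨hNR x, ?_⟩⟩
  by_cases hx : x = 0
  · simp [hx, q_zero hp]
  have hNx : 0 < N.q x := lt_of_le_of_ne (N.q_nonneg x) fun h => hx ((q_eq_zero hp).1 h.symm)
  let c : ℝ := ((1 - κ) / N.q x) ^ p⁻¹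
  have hκ0 : 0 < 1 - κ := by rw [← hκ1]; positivity
  have hc : ‖(c : 𝕜)‖ ^ p = (1 - κ) / N.q x := by
    have hc0 : 0 ≤ c := by positivity
    rw [RCLike.norm_ofReal, abs_of_nonneg hc0, ← Real.rpow_mul (by positivity),
      inv_mul_cancel₀ hp.ne', Real.rpow_one]
  have h := hball ((c : 𝕜) • x) (by rw [q_smul, hc, div_mul_cancel₀ _ hNx.ne'])
  rw [q_smul, hc, div_mul_eq_mul_div, div_le_iff₀ hNx] at h
  have h5 : (1 + ε) * (1 - κ) = 1 + κ := by
    rw [← hκ1]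
    simp only [κ]
    field_simp
    ring
  rw [← h5] at h
  refine le_of_mul_le_mul_left ?_ hκ0
  linarith

/-- Almost contractive linear maps are close to rational contractive maps. -/
theorem exists_isRationalMap_contractive_near (hp : 0 < p) (𝕜 : Type*) [RCLike 𝕜] {η : ℝ}
    (hη : 0 < η) : ∃ ε : ℝ, 0 < ε ∧ ε ≤ 1 ∧ ∀ (n m : ℕ) (N : PNorm p 𝕜 (Fin n → 𝕜))
      (M : PNorm p 𝕜 (Fin m → 𝕜)) (T : (Fin n → 𝕜) →ₗ[𝕜] (Fin m → 𝕜)),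
      (∀ x, M.q (T x) ≤ (1 + ε) * N.q x) →
      ∃ f, IsRationalMap f ∧ (∀ x, M.q (f x) ≤ N.q x) ∧ ∀ x, M.q (f x - T x) ≤ η * N.q x := by
  -- `T` is shrunk by `1 - a` before its matrix is rounded. With `b = (1 - a) ^ p`, the bound `b (1
  -- + (1 - b)/2) + (1 - b)/2 ≤ 1` leaves room for both the excess norm of `T` and the rounding
  -- error. Shrinking costs `a ^ p · 2 ≤ η / 2` and rounding at most `η / 2`. The tolerance depends
  -- on `p` and `η` only, so it can be fixed before the norms are chosen.
  let a : ℝ := min (1 / 2) ((η / 4) ^ p⁻¹)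
  have ha0 : 0 < a := by positivity
  have ha2 : a ≤ 1 / 2 := min_le_left _ _
  have hap : a ^ p ≤ η / 4 := by
    rw [← Real.le_rpow_inv_iff_of_pos ha0.le (by positivity) hp]
    exact min_le_right _ _
  let b : ℝ := (1 - a) ^ p
  have hb0 : 0 < b := Real.rpow_pos_of_pos (by linarith) p
  have hb1 : b < 1 := Real.rpow_lt_one (by linarith) (by linarith) hp
  refine ⟨(1 - b) / 2, by linarith, by linarith, fun n m N M T hT => ?_⟩
  obtain ⟨C, hC, hCle⟩ := M.exists_q_le_norm_rpow hp
  obtain ⟨D, hD, hDle⟩ := N.exists_norm_rpow_le_q hp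
  let κ : ℝ := min ((1 - b) / 2) (η / 2)
  have hκ : 0 < κ := lt_min (by linarith) (by linarith)
  have hκ1 : κ ≤ (1 - b) / 2 := min_le_left _ _
  have hκ2 : κ ≤ η / 2 := min_le_right _ _
  let δ : ℝ := (κ / (C * D)) ^ p⁻¹
  have hδp : δ ^ p * (C * D) = κ := by
    simp only [δ]
    rw [← Real.rpow_mul (by positivity), inv_mul_cancel₀ hp.ne', Real.rpow_one,
      div_mul_cancel₀ _ (by positivity)]
  have hδ : 0 < δ := by positivity
  obtain ⟨f, hf, hfT⟩ := exists_isRationalMap_norm_sub_le (((1 - a : ℝ) : 𝕜) • T) hδ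
  have hclose : ∀ x, M.q (f x - ((1 - a : ℝ) : 𝕜) • T x) ≤ κ * N.q x := by
    intro x
    have h1 := Real.rpow_le_rpow (norm_nonneg _) (hfT x) hp.le
    rw [Real.mul_rpow hδ.le (norm_nonneg x)] at h1
    calc _ ≤ C * ‖f x - ((1 - a : ℝ) : 𝕜) • T x‖ ^ p := hCle _
      _ ≤ C * (δ ^ p * (D * N.q x)) := by
          refine mul_le_mul_of_nonneg_left (h1.trans ?_) hC.le
          exact mul_le_mul_of_nonneg_left (hDle x) (by positivity)
      _ = κ * N.q x := by rw [← hδp]; ring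
  have hnorm : ∀ c : ℝ, 0 ≤ c → ‖(c : 𝕜)‖ = c := fun c hc => by
    rw [RCLike.norm_ofReal, abs_of_nonneg hc]
  refine ⟨f, hf, fun x => ?_, fun x => ?_⟩
  · have h1 := M.q_le_add_sub (f x) (((1 - a : ℝ) : 𝕜) • T x)
    rw [q_smul, hnorm _ (by linarith)] at h1
    have h2 := mul_le_mul_of_nonneg_left (hT x) hb0.le
    have h3 := mul_le_mul_of_nonneg_right hκ1 (N.q_nonneg x)
    have h4 : b * ((1 + (1 - b) / 2) * N.q x) + (1 - b) / 2 * N.q x ≤ N.q x := by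
      have : 0 ≤ (1 - b) * (1 - b) * N.q x :=
        mul_nonneg (mul_self_nonneg _) (N.q_nonneg x)
      nlinarith
    linarith [hclose x]
  · have h1 := M.q_sub_le (f x) (((1 - a : ℝ) : 𝕜) • T x) (T x)
    have h2 : ((1 - a : ℝ) : 𝕜) • T x - T x = -((a : 𝕜) • T x) := by
      push_cast
      module
    rw [h2, q_neg, q_smul, hnorm _ ha0.le] at h1
    have h3 : a ^ p * M.q (T x) ≤ η / 4 * (2 * N.q x) := by
      refine mul_le_mul hap ((hT x).trans ?_) (M.q_nonneg _) (by positivity)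
      exact mul_le_mul_of_nonneg_right (by linarith) (N.q_nonneg x)
    have h4 := mul_le_mul_of_nonneg_right hκ2 (N.q_nonneg x)
    linarith [hclose x]

end PNorm

/-! ### Approximation of a space with a 1FDD by allowed spaces -/

section Approximation

variable {p : ℝ} {𝕜 : Type*} [RCLike 𝕜] {X : Type*} [AddCommGroup X] [Module 𝕜 X]

/-- An approximation of a space by a sequence of allowed spaces `E n`, where `s n` identifies `E n`
almost isometrically with a subspace, and the rational contractions `f n` and `g n` almost agree
with the inclusions and with projections along them. -/
structure AllowedApproximation (M : PNorm p 𝕜 X) where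
  E : ℕ → AllowedSpace p 𝕜
  s : ∀ n, (Fin (E n).dim → 𝕜) →ₗ[𝕜] X
  f : ∀ n, (Fin (E n).dim → 𝕜) →ₗ[𝕜] (Fin (E (n + 1)).dim → 𝕜)
  g : ∀ n, (Fin (E (n + 1)).dim → 𝕜) →ₗ[𝕜] (Fin (E n).dim → 𝕜)
  f_rational : ∀ n, IsRationalMap (f n)
  g_rational : ∀ n, IsRationalMap (g n)
  f_le : ∀ n x, (E (n + 1)).norm.q (f n x) ≤ (E n).norm.q x
  g_le : ∀ n x, (E n).norm.q (g n x) ≤ (E (n + 1)).norm.q x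
  s_le : ∀ n x, M.q (s n x) ≤ (E n).norm.q x
  le_s : ∀ n x, (E n).norm.q x ≤ (1 + (1 / 2) ^ n) * M.q (s n x)
  s_f_sub_le : ∀ n x, M.q (s (n + 1) (f n x) - s n x) ≤ (1 / 2) ^ n * (E n).norm.q x
  g_f_sub_le : ∀ n x, (E n).norm.q (g n (f n x) - x) ≤ (1 / 2) ^ n * (E n).norm.q x
  exists_lift : ∀ n x, ∃ y, s (n + 1) y = s n x
  dense : ∀ (x : X) (ε : ℝ), 0 < ε → ∃ n z, M.q (x - s n z) < ε

theorem PNorm.IsOneComplemented.exists_projection {M : PNorm p 𝕜 X} {S S' : Submodule 𝕜 X}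
    (hS : S ≤ S') (h : (M.restrict S').IsOneComplemented (S.submoduleOf S')) :
    ∃ Q : S' →ₗ[𝕜] S, (∀ y : S, Q (Submodule.inclusion hS y) = y) ∧ ∀ x, M (Q x : X) ≤ M x := by
  obtain ⟨P, hP, hPle⟩ := h
  refine ⟨(Submodule.submoduleOfEquivOfLe hS).toLinearMap ∘ₗ P, fun y => ?_, hPle⟩
  apply Subtype.ext
  have := hP ⟨Submodule.inclusion hS y, y.2⟩
  exact congrArg (fun t : S.submoduleOf S' => ((t : S') : X)) this

/-- In coordinates, the inclusions `A n` and projections `B n` of the decomposition are almost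
contractive for nearby rational norms `R n`, hence close to rational contractions. -/
theorem PNorm.HasOneFDD.nonempty_allowedApproximation (hp : 0 < p) (hp1 : p ≤ 1) {M : PNorm p 𝕜 X}
    (hM : M.HasOneFDD) : Nonempty (AllowedApproximation M) := by
  obtain ⟨S, hSmono, hSfin, hSdense, hScompl⟩ := hM
  have hSle : ∀ n, S n ≤ S (n + 1) := fun n => hSmono (Nat.le_succ n)
  choose Q hQ hQle using fun n => (hScompl n).exists_projection (hSle n)
  let e := fun n => (Module.finBasis 𝕜 (S n)).equivFun
  let s := fun n => (S n).subtype ∘ₗ (e n).symm.toLinearMap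
  have hsinj : ∀ n, Function.Injective (s n) := fun n =>
    (S n).injective_subtype.comp (e n).symm.injective
  let A := fun n => (e (n + 1)).toLinearMap ∘ₗ Submodule.inclusion (hSle n) ∘ₗ
    (e n).symm.toLinearMap
  let B := fun n => (e n).toLinearMap ∘ₗ Q n ∘ₗ (e (n + 1)).symm.toLinearMap
  have hsA : ∀ n x, s (n + 1) (A n x) = s n x := fun n x => by simp [s, A]
  have hsB : ∀ n y, M.q (s n (B n y)) ≤ M.q (s (n + 1) y) := by
    intro n y
    rw [PNorm.q_le_q hp]
    have := hQle n ((e (n + 1)).symm y)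
    simpa [s, B] using this
  have hBA : ∀ n x, B n (A n x) = x := fun n x => by simp [A, B, hQ]
  -- A third each: `g f x - x` is the sum of `(g - B) (f x)`, of size `η`, and `B (f x - A x)`, of
  -- size `(1 + ε) η ≤ 2 η`.
  let η : ℕ → ℝ := fun n => (1 / 2) ^ n / 3
  have hη : ∀ n, 0 < η n := fun n => by positivity
  choose ε hε hε1 happrox using fun n => PNorm.exists_isRationalMap_contractive_near hp 𝕜 (hη n)
  -- `R n` is involved in the maps of index `n` and of index `n - 1`, so it must meet both
  -- tolerances; for `n = 0` these coincide.
  let ε' : ℕ → ℝ := fun n => min (min (ε n) (ε (n - 1))) ((1 / 2) ^ n)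
  have hε' : ∀ n, 0 < ε' n := fun n => lt_min (lt_min (hε _) (hε _)) (by positivity)
  have hε'1 : ∀ n, ε' n ≤ ε n := fun n => (min_le_left _ _).trans (min_le_left _ _)
  have hε'2 : ∀ n, ε' (n + 1) ≤ ε n := fun n => (min_le_left _ _).trans (min_le_right _ _)
  choose R hR hRnear using fun n =>
    PNorm.exists_isRational_near hp hp1 (M.comap (s n) (hsinj n)) (hε' n)
  have hRle : ∀ n x, M.q (s n x) ≤ (R n).q x := fun n x => (hRnear n x).1
  have hleR : ∀ n x, (R n).q x ≤ (1 + ε' n) * M.q (s n x) := fun n x => (hRnear n x).2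
  have hA : ∀ n x, (R (n + 1)).q (A n x) ≤ (1 + ε n) * (R n).q x := by
    intro n x
    refine (hleR (n + 1) _).trans ?_
    rw [hsA]
    exact mul_le_mul (by linarith [hε'2 n]) (hRle n x) (M.q_nonneg _) (by linarith [hε n])
  have hB : ∀ n y, (R n).q (B n y) ≤ (1 + ε n) * (R (n + 1)).q y := by
    intro n y
    refine (hleR n _).trans ?_
    exact mul_le_mul (by linarith [hε'1 n]) ((hsB n y).trans (hRle _ _)) (M.q_nonneg _)
      (by linarith [hε n])
  choose f hf hfle hfA using fun n => happrox n _ _ (R n) (R (n + 1)) (A n) (hA n)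
  choose g hg hgle hgB using fun n => happrox n _ _ (R (n + 1)) (R n) (B n) (hB n)
  exact ⟨{
    E := fun n => ⟨_, R n, .rational _ (hR n)⟩
    s := s
    f := f
    g := g
    f_rational := hf
    g_rational := hg
    f_le := hfle
    g_le := hgle
    s_le := hRle
    le_s := fun n x => (hleR n x).trans (mul_le_mul_of_nonneg_right
      (by linarith [min_le_right (min (ε n) (ε (n - 1))) ((1 / 2 : ℝ) ^ n)]) (M.q_nonneg _))
    s_f_sub_le := fun n x => by
      rw [← hsA n x, ← map_sub]
      refine (hRle _ _).trans ((hfA n x).trans (mul_le_mul_of_nonneg_right ?_ ((R n).q_nonneg _)))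
      have : (0 : ℝ) < (1 / 2) ^ n := by positivity
      simp only [η]
      linarith
    g_f_sub_le := fun n x => by
      have h1 := (R n).q_sub_le (g n (f n x)) (B n (f n x)) x
      have h2 : B n (f n x) - x = B n (f n x - A n x) := by rw [map_sub, hBA]
      rw [h2] at h1
      have h3 := hB n (f n x - A n x)
      have h4 := mul_le_mul_of_nonneg_right (hε1 n) ((R (n + 1)).q_nonneg (f n x - A n x))
      have h5 := mul_le_mul_of_nonneg_left (hfle n x) (hη n).le
      have h6 := hgB n (f n x)
      have h7 := hfA n x
      have h8 : (1 / 2 : ℝ) ^ n * (R n).q x = 3 * (η n * (R n).q x) := by simp only [η]; ring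
      change (R n).q _ ≤ (1 / 2 : ℝ) ^ n * (R n).q x
      rw [h8]
      linarith
    exists_lift := fun n x => ⟨A n x, hsA n x⟩
    dense := fun x δ hδ => by
      obtain ⟨n, y, hy, h⟩ := hSdense x (δ ^ (1 / p)) (by positivity)
      refine ⟨n, e n ⟨y, hy⟩, ?_⟩
      rw [PNorm.q_lt_iff hp hδ]
      simpa [s] using h }⟩

theorem AllowedApproximation.exists_lift_of_le {M : PNorm p 𝕜 X} (D : AllowedApproximation M)
    {n m : ℕ} (h : n ≤ m) (z : Fin (D.E n).dim → 𝕜) : ∃ y, D.s m y = D.s n z := by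
  induction m, h using Nat.le_induction with
  | base => exact ⟨z, rfl⟩
  | succ m h ih =>
    obtain ⟨y, hy⟩ := ih
    obtain ⟨y', hy'⟩ := D.exists_lift m y
    exact ⟨y', hy'.trans hy⟩

end Approximation

/-! ### Limits of almost contractive correspondences -/

section LimitMap

variable {p : ℝ} {𝕜 : Type*} [RCLike 𝕜] {V : Type*} [AddCommGroup V] [Module 𝕜 V]
  {W : Type*} [AddCommGroup W] [Module 𝕜 W] {Z : ℕ → Type*} [∀ l, AddCommGroup (Z l)]
  [∀ l, Module 𝕜 (Z l)]

theorem le_of_forall_le_add_half_pow {a b C : ℝ} {m : ℕ}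
    (h : ∀ l ≥ m, a ≤ b + C * (1 / 2) ^ l) : a ≤ b := by
  have ht : Filter.Tendsto (fun l : ℕ => b + C * (1 / 2 : ℝ) ^ l) Filter.atTop (nhds b) := by
    simpa using ((tendsto_pow_atTop_nhds_zero_of_lt_one (r := (1 / 2 : ℝ)) (by norm_num)
      (by norm_num)).const_mul C).const_add b
  exact ge_of_tendsto ht (Filter.eventually_atTop.2 ⟨m, h⟩)

/-- A sequence of almost contractive correspondences between `V` and `W` has a limit. -/
theorem PNorm.exists_limit_map (hp : 0 < p) (N : PNorm p 𝕜 V) {M : PNorm p 𝕜 W} (hM : M.IsComplete)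
    (a : ∀ l, Z l →ₗ[𝕜] V) (b : ∀ l, Z l →ₗ[𝕜] W)
    (hab : ∀ l z, M.q (b l z) ≤ (1 + (1 / 2) ^ l) * N.q (a l z))
    (hd : ∀ (x : V) (ε : ℝ), 0 < ε → ∃ x', N.q (x - x') < ε ∧ ∃ (z : ∀ l, Z l) (m : ℕ) (C : ℝ),
      (∀ l ≥ m, a l (z l) = x') ∧
      ∀ l ≥ m, M.q (b (l + 1) (z (l + 1)) - b l (z l)) ≤ C * (1 / 2) ^ l) :
    ∃ L : V →ₗ[𝕜] W, (∀ x, M.q (L x) ≤ N.q x) ∧ ∀ (x : V) (z : ∀ l, Z l) (m : ℕ) (C : ℝ),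
      (∀ l ≥ m, a l (z l) = x) →
      (∀ l ≥ m, M.q (b (l + 1) (z (l + 1)) - b l (z l)) ≤ C * (1 / 2) ^ l) →
      ∀ l ≥ m, M.q (b l (z l) - L x) ≤ 2 * C * (1 / 2) ^ l := by
  -- Pairs `(x, y)` such that `x` is lifted exactly at all late levels while the images of the lifts
  -- tend geometrically to `y`. The factors `1 + (1/2)^l` tend to `1`, so `G` is contractive and
  -- extends by density.
  let G : Submodule 𝕜 (V × W) :=
    { carrier := {g | ∃ (z : ∀ l, Z l) (m : ℕ) (C : ℝ), ∀ l ≥ m, a l (z l) = g.1 ∧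
        M.q (b l (z l) - g.2) ≤ C * (1 / 2) ^ l}
      zero_mem' := ⟨fun _ => 0, 0, 0, fun l _ => by simp [q_zero hp]⟩
      add_mem' := by
        rintro g g' ⟨z, m, C, h⟩ ⟨z', m', C', h'⟩
        refine ⟨fun l => z l + z' l, max m m', C + C', fun l hl => ?_⟩
        obtain ⟨h1, h2⟩ := h l (le_of_max_le_left hl)
        obtain ⟨h1', h2'⟩ := h' l (le_of_max_le_right hl)
        refine ⟨by rw [map_add, h1, h1', Prod.fst_add], ?_⟩
        rw [map_add, Prod.snd_add, ← sub_add_sub_comm]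
        linarith [M.q_add_le (b l (z l) - g.2) (b l (z' l) - g'.2)]
      smul_mem' := by
        rintro c g ⟨z, m, C, h⟩
        refine ⟨fun l => c • z l, m, ‖c‖ ^ p * C, fun l hl => ?_⟩
        obtain ⟨h1, h2⟩ := h l hl
        refine ⟨by rw [map_smul, h1, Prod.smul_fst], ?_⟩
        rw [map_smul, Prod.smul_snd, ← smul_sub, q_smul, mul_assoc]
        exact mul_le_mul_of_nonneg_left h2 (by positivity) }
  have hlim : ∀ (x : V) (z : ∀ l, Z l) (m : ℕ) (C : ℝ), (∀ l ≥ m, a l (z l) = x) →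
      (∀ l ≥ m, M.q (b (l + 1) (z (l + 1)) - b l (z l)) ≤ C * (1 / 2) ^ l) →
      ∃ y, (x, y) ∈ G ∧ ∀ l ≥ m, M.q (b l (z l) - y) ≤ 2 * C * (1 / 2) ^ l := by
    intro x z m C h1 h2
    obtain ⟨y, hy⟩ := hM.exists_limit_of_geometric hp (s := fun l => b l (z l)) h2
    exact ⟨y, ⟨z, m, 2 * C, fun l hl => ⟨h1 l hl, hy l hl⟩⟩, hy⟩
  obtain ⟨L, hL, hLG⟩ := exists_extension (N := N) hp hM G
    (by
      rintro g ⟨z, m, C, h⟩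
      refine le_of_forall_le_add_half_pow (C := N.q g.1 + C) (m := m) fun l hl => ?_
      obtain ⟨h1, h2⟩ := h l hl
      have h3 := hab l (z l)
      have h4 := M.q_le_add_sub g.2 (b l (z l))
      rw [M.q_sub_comm] at h4
      rw [h1] at h3
      linarith)
    (by
      intro x ε hε
      obtain ⟨x', hx', z, m, C, h1, h2⟩ := hd x ε hε
      obtain ⟨y, hy, -⟩ := hlim x' z m C h1 h2
      exact ⟨_, hy, hx'⟩)
  refine ⟨L, hL, fun x z m C h1 h2 => ?_⟩
  obtain ⟨y, hy, h⟩ := hlim x z m C h1 h2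
  rw [hLG _ hy]
  exact h

end LimitMap

/-! ### Absorption and the limit contractive pair -/

section Universality

variable {p : ℝ} {𝕜 : Type*} [RCLike 𝕜]

/-- A Fraïssé sequence absorbs rational contractions `φ : Uₖ → E`, `ψ : E → Uₖ`. -/
theorem AllowedSequence.IsFraisse.exists_absorb (hp : 0 < p) {U : AllowedSequence p 𝕜}
    (hU : U.IsFraisse) (k : ℕ) (E : AllowedSpace p 𝕜)
    (φ : (Fin (U.space k).dim → 𝕜) →ₗ[𝕜] (Fin E.dim → 𝕜))
    (ψ : (Fin E.dim → 𝕜) →ₗ[𝕜] (Fin (U.space k).dim → 𝕜))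
    (hφ : IsRationalMap φ) (hψ : IsRationalMap ψ)
    (hφle : ∀ u, E.norm (φ u) ≤ (U.space k).norm u)
    (hψle : ∀ x, (U.space k).norm (ψ x) ≤ E.norm x) :
    ∃ j, 1 ≤ j ∧ ∃ J : AllowedPair E (U.space (k + j)),
      (∀ u, J.1.proj ((U.bond k j).emb u) = φ u) ∧
      ∀ u, (U.space (k + j)).norm (J.1.emb (φ u) - (U.bond k j).emb u) ≤
        (U.space k).norm (ψ (φ u) - u) := by
  let F := (U.space k).prod hp E
  have hF : ∀ x y, F.norm (Fin.append x y) = max ((U.space k).norm x) (E.norm y) :=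
    PNorm.prod_append hp _ _
  -- `v` is the graph of `φ` and `c` the graph of `ψ` in the same product, each with its own
  -- coordinate projection; `φ` and `ψ` need not be related.
  let v : ContractivePair (U.space k).norm F.norm :=
    { emb := appendMap LinearMap.id φ
      proj := leftMap 𝕜 _ _
      proj_emb := fun x => leftMap_append _ _
      emb_le := fun x => (hF _ _).trans_le (max_le le_rfl (hφle x))
      proj_le := PNorm.left_le_prod hp _ _ }
  let c : ContractivePair E.norm F.norm :=
    { emb := appendMap ψ LinearMap.id
      proj := rightMap 𝕜 _ _
      proj_emb := fun x => rightMap_append _ _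
      emb_le := fun x => (hF _ _).trans_le (max_le (hψle x) le_rfl)
      proj_le := PNorm.right_le_prod hp _ _ }
  obtain ⟨j, hj, w, hw, hwv⟩ := hU k F v ⟨IsRationalMap.id.appendMap hφ, IsRationalMap.leftMap⟩
  refine ⟨j, hj, AllowedPair.comp ⟨w, hw⟩
    ⟨c, hψ.appendMap IsRationalMap.id, IsRationalMap.rightMap⟩, fun u => ?_, fun u => ?_⟩
  · rw [← hwv]
    change rightMap 𝕜 _ _ (w.proj (w.emb (Fin.append u (φ u)))) = φ u
    exact (congrArg (rightMap 𝕜 _ _) (w.proj_emb _)).trans (rightMap_append _ _)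
  · rw [← hwv]
    change (U.space (k + j)).norm (w.emb (c.emb (φ u)) - w.emb (v.emb u)) ≤ _
    rw [← map_sub]
    refine (w.emb_le _).trans ?_
    -- Over `u` the two graphs agree in the second coordinate, so the maximum norm sees only the
    -- defect of `ψ φ` in the first.
    have h : c.emb (φ u) - v.emb u = appendMap LinearMap.id 0 (ψ (φ u) - u) := by
      change Fin.append (ψ (φ u)) (φ u) - Fin.append u (φ u) = Fin.append (ψ (φ u) - u) 0
      ext i
      induction i using Fin.addCases <;> simp
    rw [h]
    refine (hF _ _).trans_le (max_le le_rfl ?_)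
    rw [LinearMap.zero_apply, PNorm.map_zero]
    exact PNorm.nonneg' _ _

variable {K : Type*} [AddCommGroup K] [Module 𝕜 K] {X : Type*} [AddCommGroup X] [Module 𝕜 X]

theorem AllowedSequence.bond_compat (U : AllowedSequence p 𝕜)
    {i : ∀ n, (Fin (U.space n).dim → 𝕜) →ₗ[𝕜] K}
    (hi : ∀ n x, i (n + 1) ((U.pair n).emb x) = i n x) (n k : ℕ) (x : Fin (U.space n).dim → 𝕜) :
    i (n + k) ((U.bond n k).emb x) = i n x := by
  induction k with
  | zero => rfl
  | succ k ih => exact (hi (n + k) _).trans ih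

/-- The direct limit of a Fraïssé sequence contains contractively complemented copies of the spaces
that are approximable by allowed spaces. -/
theorem AllowedSequence.IsFraisse.exists_contractive_pair (hp : 0 < p) {U : AllowedSequence p 𝕜}
    (hU : U.IsFraisse) {N : PNorm p 𝕜 K} (hN : U.IsDirectLimit N) {M : PNorm p 𝕜 X}
    (hM : M.IsComplete) (D : AllowedApproximation M) : Nonempty (ContractivePair M N) := by
  obtain ⟨hNc, i, hiso, hcompat, hdense⟩ := hN
  have hisoq : ∀ n x, N.q (i n x) = (U.space n).norm.q x := fun n x => by
    rw [PNorm.q, hiso, PNorm.q]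
  have hinj : ∀ n, Function.Injective (i n) := by
    intro n
    rw [injective_iff_map_eq_zero]
    intro x hx
    rw [← (U.space n).norm.eq_zero_iff', ← hiso, hx, N.map_zero]
  have hstep : ∀ (n : ℕ) (t : Σ k, AllowedPair (D.E n) (U.space k)),
      ∃ t' : Σ k, AllowedPair (D.E (n + 1)) (U.space k), t.1 < t'.1 ∧
        ∃ b : (Fin (U.space t.1).dim → 𝕜) →ₗ[𝕜] (Fin (U.space t'.1).dim → 𝕜),
          (∀ u, i t'.1 (b u) = i t.1 u) ∧ (∀ u, t'.2.1.proj (b u) = D.f n (t.2.1.proj u)) ∧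
          ∀ x, N.q (i t'.1 (t'.2.1.emb (D.f n x)) - i t.1 (t.2.1.emb x)) ≤
            (1 / 2) ^ n * (D.E n).norm.q x := by
    rintro n ⟨k, J⟩
    -- At `u = J♭ x` the defect of these contractions is `J♭ (g f x - x)`, which is controlled by
    -- `g_f_sub_le`.
    obtain ⟨j, hj, J', h1, h2⟩ := hU.exists_absorb hp k (D.E (n + 1)) (D.f n ∘ₗ J.1.proj)
      (J.1.emb ∘ₗ D.g n) ((D.f_rational n).comp J.2.2) (J.2.1.comp (D.g_rational n))
      (fun u => ((PNorm.q_le_q hp).1 (D.f_le n _)).trans (J.1.proj_le u))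
      (fun x => (J.1.emb_le _).trans ((PNorm.q_le_q hp).1 (D.g_le n _)))
    refine ⟨⟨k + j, J'⟩, by dsimp only; omega, (U.bond k j).emb, U.bond_compat hcompat k j, h1,
      fun x => ?_⟩
    have h3 := h2 (J.1.emb x)
    simp only [LinearMap.comp_apply, J.1.proj_emb] at h3
    rw [← map_sub] at h3
    dsimp only
    rw [← U.bond_compat hcompat k j, ← map_sub, hisoq]
    exact ((PNorm.q_le_q hp).2 (h3.trans (J.1.emb_le _))).trans (D.g_f_sub_le n x)
  have hstart : Nonempty (Σ k, AllowedPair (D.E 0) (U.space k)) := by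
    obtain ⟨j, -, J, -⟩ := hU.exists_absorb hp 0 (D.E 0) 0 0 IsRationalMap.zero IsRationalMap.zero
      (fun u => by
        rw [LinearMap.zero_apply, PNorm.map_zero]
        exact PNorm.nonneg' _ _)
      (fun u => by
        rw [LinearMap.zero_apply, PNorm.map_zero]
        exact PNorm.nonneg' _ _)
    exact ⟨⟨_, J⟩⟩
  obtain ⟨t₀⟩ := hstart
  choose next hlt b hib hPb hJf using hstep
  let t : ∀ n, Σ k, AllowedPair (D.E n) (U.space k) := fun n => Nat.rec t₀ next n
  let k : ℕ → ℕ := fun n => (t n).1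
  let J : ∀ n, AllowedPair (D.E n) (U.space (k n)) := fun n => (t n).2
  let β : ∀ n, (Fin (U.space (k n)).dim → 𝕜) →ₗ[𝕜] (Fin (U.space (k (n + 1))).dim → 𝕜) :=
    fun n => b n (t n)
  -- Needed for density: every `Uₙ` is contained in `U_{k n}`.
  have hkn : ∀ n, n ≤ k n := by
    intro n
    induction n with
    | zero => exact Nat.zero_le _
    | succ n ih => exact Nat.succ_le_of_lt (ih.trans_lt (hlt n (t n)))
  have hiβ : ∀ n u, i (k (n + 1)) (β n u) = i (k n) u := fun n => hib n (t n)
  have hPβ : ∀ n u, (J (n + 1)).1.proj (β n u) = D.f n ((J n).1.proj u) := fun n => hPb n (t n)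
  have hJf' : ∀ n x, N.q (i (k (n + 1)) ((J (n + 1)).1.emb (D.f n x)) - i (k n) ((J n).1.emb x)) ≤
      (1 / 2) ^ n * (D.E n).norm.q x := fun n => hJf n (t n)
  have hiJ : ∀ l x, N.q (i (k l) ((J l).1.emb x)) ≤ (D.E l).norm.q x := fun l x => by
    rw [hisoq]
    exact (PNorm.q_le_q hp).2 ((J l).1.emb_le x)
  have hsP : ∀ l u, (D.E l).norm.q ((J l).1.proj u) ≤ N.q (i (k l) u) := fun l u => by
    rw [hisoq]
    exact (PNorm.q_le_q hp).2 ((J l).1.proj_le u)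
  have hpow1 : ∀ l : ℕ, (1 / 2 : ℝ) ^ l ≤ 1 := fun l => pow_le_one₀ (by norm_num) (by norm_num)
  have hpow0 : ∀ l : ℕ, (0 : ℝ) < (1 / 2) ^ l := fun l => by positivity
  have hE2 : ∀ l x, (D.E l).norm.q x ≤ 2 * M.q (D.s l x) := fun l x =>
    (D.le_s l x).trans (mul_le_mul_of_nonneg_right (by linarith [hpow1 l]) (M.q_nonneg _))
  -- Compare through `f (z l)`. The discrepancy between `z (l + 1)` and `f (z l)` contributes `4`
  -- and the step from `J l` to `J (l + 1)` contributes `2`, because `E l` and `X` differ by a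
  -- factor at most `2`.
  have hincJ : ∀ (x' : X) (z : ∀ l, Fin (D.E l).dim → 𝕜) (m : ℕ), (∀ l ≥ m, D.s l (z l) = x') →
      ∀ l ≥ m, N.q (i (k (l + 1)) ((J (l + 1)).1.emb (z (l + 1))) - i (k l) ((J l).1.emb (z l))) ≤
        6 * M.q x' * (1 / 2) ^ l := by
    intro x' z m hz l hl
    have h1 := N.q_sub_le (i (k (l + 1)) ((J (l + 1)).1.emb (z (l + 1))))
      (i (k (l + 1)) ((J (l + 1)).1.emb (D.f l (z l)))) (i (k l) ((J l).1.emb (z l)))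
    rw [← map_sub, ← map_sub] at h1
    have h2 := (hiJ (l + 1) (z (l + 1) - D.f l (z l))).trans (hE2 _ _)
    rw [map_sub (D.s (l + 1)), hz (l + 1) (by omega), M.q_sub_comm, ← hz l hl] at h2
    have h3 := D.s_f_sub_le l (z l)
    have h4 := hJf' l (z l)
    have h5 := mul_le_mul_of_nonneg_left (hE2 l (z l)) (hpow0 l).le
    rw [← hz l hl]
    linarith
  obtain ⟨L, hL, hLz⟩ := PNorm.exists_limit_map (p := p) hp M hNc D.s
    (fun l => i (k l) ∘ₗ (J l).1.emb)
    (fun l z => (hiJ l z).trans (D.le_s l z))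
    (by
      intro x ε hε
      obtain ⟨n, z₀, h⟩ := D.dense x ε hε
      have hz : ∀ l, ∃ z, n ≤ l → D.s l z = D.s n z₀ := by
        intro l
        by_cases hl : n ≤ l
        · obtain ⟨z, hz⟩ := D.exists_lift_of_le hl z₀
          exact ⟨z, fun _ => hz⟩
        · exact ⟨0, fun h => absurd h hl⟩
      choose z hz using hz
      exact ⟨_, h, z, n, _, hz, hincJ _ z n hz⟩)
  have hincP : ∀ (y : K) (z : ∀ l, Fin (U.space (k l)).dim → 𝕜) (m : ℕ),
      (∀ l ≥ m, i (k l) (z l) = y) → ∀ l ≥ m,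
      M.q (D.s (l + 1) ((J (l + 1)).1.proj (z (l + 1))) - D.s l ((J l).1.proj (z l))) ≤
        N.q y * (1 / 2) ^ l := by
    intro y z m hz l hl
    -- Lifts to the `U`'s are unique, and on them the projections are intertwined exactly by `f l`,
    -- so the only error is that of `s` along `f`.
    have h1 : z (l + 1) = β l (z l) := hinj _ (by rw [hiβ, hz l hl, hz (l + 1) (by omega)])
    rw [h1, hPβ, mul_comm, ← hz l hl]
    exact (D.s_f_sub_le l _).trans (mul_le_mul_of_nonneg_left (hsP l _) (hpow0 l).le)
  have hliftP : ∀ (m : ℕ) (u : Fin (U.space (k m)).dim → 𝕜),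
      ∃ z : ∀ l, Fin (U.space (k l)).dim → 𝕜, ∀ l ≥ m, i (k l) (z l) = i (k m) u := by
    intro m u
    have hz : ∀ l, ∃ z, m ≤ l → i (k l) z = i (k m) u := by
      intro l
      by_cases hl : m ≤ l
      · induction l, hl using Nat.le_induction with
        | base => exact ⟨u, fun _ => rfl⟩
        | succ l hl ih =>
          obtain ⟨z, hz⟩ := ih
          exact ⟨β l z, fun _ => by rw [hiβ, hz hl]⟩
      · exact ⟨0, fun h => absurd h hl⟩
    choose z hz using hz
    exact ⟨z, hz⟩
  obtain ⟨P, hP, hPz⟩ := PNorm.exists_limit_map (p := p) hp N hM (fun l => i (k l))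
    (fun l => D.s l ∘ₗ (J l).1.proj)
    (fun l z => by
      have h1 := (D.s_le l ((J l).1.proj z)).trans (hsP l z)
      have h2 := mul_nonneg (hpow0 l).le (N.q_nonneg (i (k l) z))
      rw [LinearMap.comp_apply]
      linarith)
    (by
      intro y ε hε
      obtain ⟨n, x, h⟩ := hdense y (ε ^ (1 / p)) (by positivity)
      rw [← PNorm.q_lt_iff hp hε] at h
      obtain ⟨j, hj⟩ := Nat.exists_eq_add_of_le (hkn n)
      have hx : ∃ u, i (k n) u = i n x := by
        rw [hj]
        exact ⟨_, U.bond_compat hcompat n j x⟩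
      obtain ⟨u, hu⟩ := hx
      obtain ⟨z, hz⟩ := hliftP n u
      exact ⟨i n x, h, z, n, _, fun l hl => (hz l hl).trans hu,
        hincP _ z n fun l hl => (hz l hl).trans hu⟩)
  have hPJ : ∀ m x, M.q (D.s m x - P (i (k m) ((J m).1.emb x))) ≤
      2 * (D.E m).norm.q x * (1 / 2) ^ m := by
    intro m x
    obtain ⟨z, hz⟩ := hliftP m ((J m).1.emb x)
    have h1 := hPz _ z m _ hz (hincP _ z m hz) m le_rfl
    have h2 : z m = (J m).1.emb x := hinj _ (hz m le_rfl)
    rw [LinearMap.comp_apply, h2, (J m).1.proj_emb] at h1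
    refine h1.trans ?_
    have := mul_le_mul_of_nonneg_right (hiJ m x) (hpow0 m).le
    linarith
  have hPL : ∀ n z₀, P (L (D.s n z₀)) = D.s n z₀ := by
    intro n z₀
    have hz : ∀ l, ∃ z, n ≤ l → D.s l z = D.s n z₀ := by
      intro l
      by_cases hl : n ≤ l
      · obtain ⟨z, hz⟩ := D.exists_lift_of_le hl z₀
        exact ⟨z, fun _ => hz⟩
      · exact ⟨0, fun h => absurd h hl⟩
    choose z hz using hz
    generalize D.s n z₀ = x at hz ⊢
    have h0 : M.q (x - P (L x)) ≤ 0 := by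
      -- Pass through `P (J♭ (z l))`, which is within `4 M.q x (1/2)^l` of `x` by `hPJ`; the
      -- distance of `J♭ (z l)` from `L x` is at most `12 M.q x (1/2)^l`.
      refine le_of_forall_le_add_half_pow (C := 16 * M.q x) (m := n) fun l hl => ?_
      have h1 := hPJ l (z l)
      have h2 := hLz x z n _ hz (hincJ x z n hz) l hl
      have h3 := M.q_sub_le x (P (i (k l) ((J l).1.emb (z l)))) (P (L x))
      rw [← map_sub] at h3
      have h4 := hP (i (k l) ((J l).1.emb (z l)) - L x)
      have h5 := mul_le_mul_of_nonneg_right (hE2 l (z l)) (hpow0 l).le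
      rw [hz l hl] at h1 h5
      rw [LinearMap.comp_apply] at h2
      linarith
    exact (sub_eq_zero.1 ((PNorm.q_eq_zero hp).1 (le_antisymm h0 (M.q_nonneg _)))).symm
  refine ⟨⟨L, P, fun x => ?_, fun x => (PNorm.q_le_q hp).1 (hL x),
    fun y => (PNorm.q_le_q hp).1 (hP y)⟩⟩
  refine PNorm.eq_of_forall_q_lt (N := M) hp fun ε hε => ?_
  obtain ⟨n, z, h⟩ := D.dense x (ε / 2) (half_pos hε)
  have h1 := M.q_sub_le (P (L x)) (P (L (D.s n z))) x
  rw [← map_sub, ← map_sub, hPL, M.q_sub_comm (D.s n z) x] at h1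
  have h2 := (hP _).trans (hL (x - D.s n z))
  linarith

end Universality

theorem mainTheorem5 (p : ℝ) (hp0 : 0 < p) (hp1 : p ≤ 1) (𝕜 : Type u) [RCLike 𝕜] :
    (∃ (K : Type u) (_ : AddCommGroup K) (_ : Module 𝕜 K) (N : PNorm p 𝕜 K), IsKpSpace N) ∧
    ∀ (K : Type v) [AddCommGroup K] [Module 𝕜 K] (N : PNorm p 𝕜 K), IsKpSpace N →
      ∀ (X : Type w) [AddCommGroup X] [Module 𝕜 X] (M : PNorm p 𝕜 X),
        M.IsComplete → M.HasOneFDD →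
          ∃ Y : Submodule 𝕜 K,
            (∃ e : X ≃ₗ[𝕜] Y, ∀ x, N (e x : K) = M x) ∧ N.IsOneComplemented Y := by
  refine ⟨?_, ?_⟩
  · obtain ⟨U, hU⟩ := exists_isFraisse hp0 𝕜
    exact ⟨_, _, _, _, U, hU, U.isDirectLimit_supNorm hp0⟩
  · rintro K _ _ N ⟨U, hU, hN⟩ X _ _ M hMc hM
    obtain ⟨D⟩ := hM.nonempty_allowedApproximation hp0 hp1
    obtain ⟨u⟩ := hU.exists_contractive_pair hp0 hN hMc D
    have hinj : Function.Injective u.emb := Function.LeftInverse.injective u.proj_emb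
    refine ⟨LinearMap.range u.emb, ⟨LinearEquiv.ofInjective u.emb hinj, u.norm_emb⟩,
      u.emb.rangeRestrict ∘ₗ u.proj, ?_, fun y => (u.emb_le _).trans (u.proj_le y)⟩
    rintro ⟨_, x, rfl⟩
    exact Subtype.ext (congrArg u.emb (u.proj_emb x))
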